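/- Let $n\in\mathbb N$, $1\le q<\infty$ and $s>1$. Write $\langle x\rangle=(1+|x|^2)^{1/2}$ for $x\in\mathbb R^n$. Fix a window $g\in\mathcal S(\mathbb R^n)\setminus\{0\}$. For $f\in\mathcal S'(\mathbb R^n)$ let \[ V_g f(x,\xi)=(2\pi)^{-n/2}\,\big\langle f,\ \overline{g(\cdot-x)}\,e^{-i(\cdot)\cdot\xi}\big\rangle \] be its short-time Fourier transform, where $\langle f,\psi\rangle$ denotes the (bilinear) pairing of $f\in\mathcal S'(\mathbb R^n)$ with $\psi\in\mathcal S(\mathbb R^n)$, and let $\mathring M^{\infty,q}_s(\mathbb R^n)$ be the set of all $f\in\mathcal S'(\mathbb R^n)$ with \[ \|f\|_{\mathring M^{\infty,q}_s}=\Big(\int_{\mathbb R^n}\big(\operatorname*{ess\,sup}_{x\in\mathbb R^n}|V_g f(x,\xi)|\,\langle\xi\rangle^{s}\big)^q\,d\xi\Big)^{1/q}<\infty . \] Let $\ell^q_s(\mathbb Z^n)$ be the set of all families $(c_\alpha)_{\alpha\in\mathbb Z^n}$ of complex numbers with $\sum_{\alpha}\langle\alpha\rangle^{sq}|c_\alpha|^q<\infty$.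 Let $\phi\in\mathcal S(\mathbb R^n)$ satisfy $\sum_{\alpha\in\mathbb Z^n}\phi(x-2\pi\alpha)=1$ for all $x\in\mathbb R^n$. If $f\in\mathcal S'(\mathbb R^n)$ is $2\pi$-periodic in each variable, then \[ f=\sum_{\alpha\in\mathbb Z^n}c_\alpha e^{ix\cdot\alpha}\quad\text{with (unconditional) weak convergence in }\mathcal S'(\mathbb R^n),\qquad c_\alpha=(2\pi)^{-n}\big\langle f,\ \phi\,e^{-i(\cdot)\cdot\alpha}\big\rangle . \] Moreover, $f\in\mathring M^{\infty,q}_s(\mathbb R^n)$ if and only if $(c_\alpha)_{\alpha\in\mathbb Z^n}\in\ell^q_s(\mathbb Z^n)$. -/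

import Mathlib

open MeasureTheory Complex
open scoped SchwartzMap ENNReal Real

noncomputable section

namespace PeriodicModulation

/-- Euclidean space `ℝⁿ`. -/
abbrev Rn (n : ℕ) : Type := EuclideanSpace ℝ (Fin n)

/-- The lattice point `α ∈ ℤⁿ`, seen as a vector of `ℝⁿ`. -/
def latticePoint {n : ℕ} (α : Fin n → ℤ) : Rn n :=
  WithLp.toLp 2 (fun j => (α j : ℝ))

/-- The plane wave `x ↦ e^{i x·ξ}`. -/
def planeWave {n : ℕ} (ξ : Rn n) (x : Rn n) : ℂ :=
  Complex.exp (((inner ℝ ξ x : ℝ) : ℂ) * Complex.I)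

theorem iteratedDeriv_exp_mul_I (k : ℕ) :
    iteratedDeriv k (fun t : ℝ => Complex.exp ((t : ℂ) * Complex.I)) =
      fun t : ℝ => Complex.I ^ k * Complex.exp ((t : ℂ) * Complex.I) := by
  induction k with
  | zero => simp
  | succ k ih =>
    rw [iteratedDeriv_succ, ih]
    funext t
    have h : HasDerivAt (fun t : ℝ => Complex.exp ((t : ℂ) * Complex.I))
        (Complex.exp ((t : ℂ) * Complex.I) * (1 * Complex.I)) t :=
      ((Complex.ofRealCLM.hasDerivAt (x := t)).mul_const Complex.I).cexp
    rw [(h.const_mul (Complex.I ^ k)).deriv]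
    ring

theorem hasTemperateGrowth_exp_mul_I :
    (fun t : ℝ => Complex.exp ((t : ℂ) * Complex.I)).HasTemperateGrowth := by
  refine ⟨(Complex.ofRealCLM.contDiff.mul contDiff_const).cexp, fun k => ⟨0, 1, fun t => ?_⟩⟩
  rw [norm_iteratedFDeriv_eq_norm_iteratedDeriv, iteratedDeriv_exp_mul_I]
  simp [Complex.norm_exp_ofReal_mul_I]

theorem hasTemperateGrowth_planeWave {n : ℕ} (ξ : Rn n) :
    (planeWave ξ).HasTemperateGrowth :=
  hasTemperateGrowth_exp_mul_I.comp (Function.hasTemperateGrowth_inner_right ξ)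

/-- The tempered distribution given by the function `x ↦ e^{i x·α}`, for `α ∈ ℤⁿ`. -/
def character {n : ℕ} (α : Fin n → ℤ) : 𝓢'(Rn n, ℂ) :=
  (hasTemperateGrowth_planeWave (latticePoint α)).toTemperedDistribution volume

theorem character_apply {n : ℕ} (α : Fin n → ℤ) (ψ : 𝓢(Rn n, ℂ)) :
    character α ψ = ∫ x, ψ x * Complex.exp (((inner ℝ (latticePoint α) x : ℝ) : ℂ) * Complex.I) :=
  rfl

/-- The Schwartz function `y ↦ ψ(y) e^{-i y·ξ}`. -/
def demodulate {n : ℕ} (ξ : Rn n) (ψ : 𝓢(Rn n, ℂ)) : 𝓢(Rn n, ℂ) :=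
  SchwartzMap.smulLeftCLM ℂ (planeWave (-ξ)) ψ

theorem demodulate_apply {n : ℕ} (ξ : Rn n) (ψ : 𝓢(Rn n, ℂ)) (y : Rn n) :
    demodulate ξ ψ y = ψ y * Complex.exp (-(((inner ℝ ξ y : ℝ) : ℂ) * Complex.I)) := by
  rw [demodulate, SchwartzMap.smulLeftCLM_apply_apply (hasTemperateGrowth_planeWave (-ξ))]
  simp [planeWave, mul_comm]

/-- The Schwartz function `y ↦ conj (g (y - x)) e^{-i y·ξ}`, i.e. the complex conjugate of
`M_ξ T_x g`. -/
def conjTimeFreqShift {n : ℕ} (g : 𝓢(Rn n, ℂ)) (x ξ : Rn n) : 𝓢(Rn n, ℂ) :=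
  demodulate ξ
    (SchwartzMap.postcompCLM (𝕜 := ℝ) (Complex.conjCLE : ℂ →L[ℝ] ℂ)
      (SchwartzMap.compSubConstCLM ℂ x g))

theorem conjTimeFreqShift_apply {n : ℕ} (g : 𝓢(Rn n, ℂ)) (x ξ y : Rn n) :
    conjTimeFreqShift g x ξ y =
      (starRingEnd ℂ) (g (y - x)) * Complex.exp (-(((inner ℝ ξ y : ℝ) : ℂ) * Complex.I)) := by
  simp [conjTimeFreqShift, demodulate_apply]

/-- The short-time Fourier transform of a tempered distribution `f` with window `g`,
`V_g f(x, ξ) = (2π)^{-n/2} ∫ f(y) conj (g (y - x)) e^{-i y·ξ} dy`, the integral being the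
distributional pairing. -/
def stft {n : ℕ} (g : 𝓢(Rn n, ℂ)) (f : 𝓢'(Rn n, ℂ)) (x ξ : Rn n) : ℂ :=
  (((2 * π) ^ (-(n : ℝ) / 2) : ℝ) : ℂ) * f (conjTimeFreqShift g x ξ)

/-- The weight `⟨x⟩^s = (1 + |x|²)^{s/2}`. -/
def weight {n : ℕ} (s : ℝ) (x : Rn n) : ℝ :=
  (1 + ‖x‖ ^ 2) ^ (s / 2)

/-- The norm of the weighted modulation space `M̊^{p,q}_{s,σ}(ℝⁿ)` with respect to the window `g`:
the `L^q` norm in `ξ` of the `L^p` norm in `x` of `V_g f(x, ξ) ⟨x⟩^σ ⟨ξ⟩^s`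
(essential suprema when an exponent is `∞`), with values in `[0, ∞]`. -/
def modulationNorm {n : ℕ} (g : 𝓢(Rn n, ℂ)) (p q : ℝ≥0∞) (s σ : ℝ) (f : 𝓢'(Rn n, ℂ)) : ℝ≥0∞ :=
  eLpNorm
    (fun ξ : Rn n =>
      eLpNorm (fun x : Rn n => stft g f x ξ * ((weight σ x * weight s ξ : ℝ) : ℂ)) p volume)
    q volume

/-- The weighted modulation space `M̊^{p,q}_{s,σ}(ℝⁿ)`, defined with the window `g`. -/
def modulationSpace {n : ℕ} (g : 𝓢(Rn n, ℂ)) (p q : ℝ≥0∞) (s σ : ℝ) : Set (𝓢'(Rn n, ℂ)) :=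
  {f | modulationNorm g p q s σ f < ∞}

/-- The weighted sequence space `ℓ^q_s(ℤⁿ)`: all `c` such that `(⟨α⟩^s c_α)_α` lies in `ℓ^q`. -/
def weightedSequenceSpace (n : ℕ) (q : ℝ≥0∞) (s : ℝ) : Set ((Fin n → ℤ) → ℂ) :=
  {c | Memℓp (fun α => ((weight s (latticePoint α) : ℝ) : ℂ) * c α) q}

/-- The distribution `f` has period `2π` in each variable: it is invariant under the translations
by `2π e_j` (equivalently, pairing with `f` is invariant under these translations of the test
function). -/
def IsPeriodic {n : ℕ} (f : 𝓢'(Rn n, ℂ)) : Prop :=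
  ∀ (j : Fin n) (ψ : 𝓢(Rn n, ℂ)),
    f (SchwartzMap.compSubConstCLM ℂ (EuclideanSpace.single j (2 * π)) ψ) = f ψ

/-- The translates of `φ` by the period lattice `2πℤⁿ` sum to one. -/
def IsPeriodicPartition {n : ℕ} (φ : 𝓢(Rn n, ℂ)) : Prop :=
  ∀ x : Rn n, HasSum (fun α : Fin n → ℤ => φ (x - (2 * π) • latticePoint α)) 1

/-- The Fourier coefficient `c_α = (2π)^{-n} ∫ f(x) φ(x) e^{-i x·α} dx` of a periodic
distribution `f`, the integral being the distributional pairing. -/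
def fourierCoefficient {n : ℕ} (φ : 𝓢(Rn n, ℂ)) (f : 𝓢'(Rn n, ℂ)) (α : Fin n → ℤ) : ℂ :=
  ((((2 * π) ^ n)⁻¹ : ℝ) : ℂ) * f (demodulate (latticePoint α) φ)

end PeriodicModulation

end

/-!
Writing `⟨f, ψ⟩ = ⟨f, φ Σ_β ψ(· + 2πβ)⟩` for periodic `f` and expanding the periodisation of `ψ` by
Poisson summation gives the Fourier series of `f`. Applied to `ψ = conj (M_ξ T_x g)`, it shows that
`e^{i x·ξ} V_g f(x, ξ)` is, as a function of `x`, the trigonometric series with coefficients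
`(2π)^{-n/2} c_α G(ξ - α)`, where `G` is the Fourier transform of `conj g`. The supremum in `x` of
such a series is at most the `ℓ¹` norm of its coefficients and, up to a constant, at least each of
them. The upper bound is a discrete convolution of `⟨α⟩^s |c_α|` with a rapidly decreasing kernel
(Peetre's inequality moves the weight), hence bounded on `ℓ^q`; the lower bound is used for `ξ` in
disjoint balls around the translates by `α` of a point where `G ≠ 0`.
-/
namespace PeriodicModulation

open Filter Topology
open scoped FourierTransform

section SchwartzSeries

variable {ι E F : Type*} [NormedAddCommGroup E] [NormedSpace ℝ E]
  [NormedAddCommGroup F] [NormedSpace ℝ F]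

theorem norm_iteratedFDeriv_le_seminorm (v : 𝓢(E, F)) (l : ℕ) (x : E) :
    ‖iteratedFDeriv ℝ l v x‖ ≤ SchwartzMap.seminorm ℝ 0 l v := by
  simpa using v.le_seminorm ℝ 0 l x

/-- Absolute summability of a family of Schwartz functions with respect to every Schwartz
seminorm. -/
def SeminormSummable (u : ι → 𝓢(E, F)) : Prop :=
  ∀ k l : ℕ, Summable fun i => SchwartzMap.seminorm ℝ k l (u i)

namespace SeminormSummable

variable {u : ι → 𝓢(E, F)}

theorem comp_injective (hu : SeminormSummable u) {κ : Type*} {e : κ → ι}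
    (he : Function.Injective e) : SeminormSummable fun k => u (e k) :=
  fun k l => (hu k l).comp_injective he

theorem summable_norm_iteratedFDeriv (hu : SeminormSummable u) (l : ℕ) (x : E) :
    Summable fun i => ‖iteratedFDeriv ℝ l (u i) x‖ :=
  (hu 0 l).of_nonneg_of_le (fun _ => norm_nonneg _) fun i =>
    norm_iteratedFDeriv_le_seminorm (u i) l x

theorem iteratedFDeriv_tsum [CompleteSpace F] (hu : SeminormSummable u) (l : ℕ) (x : E) :
    iteratedFDeriv ℝ l (fun y => ∑' i, u i y) x = ∑' i, iteratedFDeriv ℝ l (u i) x :=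
  iteratedFDeriv_tsum_apply (N := (⊤ : ℕ∞)) (fun i => (u i).smooth ⊤) (fun l _ => hu 0 l)
    (fun l i x _ => norm_iteratedFDeriv_le_seminorm (u i) l x) le_top x

theorem norm_pow_mul_norm_iteratedFDeriv_tsum_le [CompleteSpace F] (hu : SeminormSummable u)
    (k l : ℕ) (x : E) :
    ‖x‖ ^ k * ‖iteratedFDeriv ℝ l (fun y => ∑' i, u i y) x‖ ≤
      ∑' i, SchwartzMap.seminorm ℝ k l (u i) := by
  have hnorm := hu.summable_norm_iteratedFDeriv l x
  calc ‖x‖ ^ k * ‖iteratedFDeriv ℝ l (fun y => ∑' i, u i y) x‖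
      ≤ ‖x‖ ^ k * ∑' i, ‖iteratedFDeriv ℝ l (u i) x‖ := by
        rw [hu.iteratedFDeriv_tsum]
        gcongr
        exact norm_tsum_le_tsum_norm hnorm
    _ = ∑' i, ‖x‖ ^ k * ‖iteratedFDeriv ℝ l (u i) x‖ := tsum_mul_left.symm
    _ ≤ ∑' i, SchwartzMap.seminorm ℝ k l (u i) :=
        (hnorm.mul_left _).tsum_le_tsum (fun i => (u i).le_seminorm ℝ k l x) (hu k l)

/-- The pointwise sum of a seminorm-summable family, as a Schwartz function. -/
noncomputable def sum [CompleteSpace F] (hu : SeminormSummable u) : 𝓢(E, F) where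
  toFun x := ∑' i, u i x
  smooth' := contDiff_tsum (N := (⊤ : ℕ∞)) (fun i => (u i).smooth ⊤) (fun l _ => hu 0 l)
    fun l i x _ => norm_iteratedFDeriv_le_seminorm (u i) l x
  decay' k l := ⟨_, hu.norm_pow_mul_norm_iteratedFDeriv_tsum_le k l⟩

theorem seminorm_sum_le [CompleteSpace F] (hu : SeminormSummable u) (k l : ℕ) :
    SchwartzMap.seminorm ℝ k l hu.sum ≤ ∑' i, SchwartzMap.seminorm ℝ k l (u i) :=
  SchwartzMap.seminorm_le_bound ℝ k l _ (tsum_nonneg fun _ => apply_nonneg _ _)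
    (hu.norm_pow_mul_norm_iteratedFDeriv_tsum_le k l)

theorem sum_sub_finsetSum [CompleteSpace F] (hu : SeminormSummable u) (s : Finset ι) :
    hu.sum - ∑ i ∈ s, u i =
      (hu.comp_injective (Subtype.val_injective (p := fun i => i ∉ s))).sum := by
  ext x
  have hsum : Summable fun i => u i x :=
    .of_norm (by simpa using hu.summable_norm_iteratedFDeriv 0 x)
  rw [sub_apply, sum_apply, sub_eq_iff_eq_add']
  exact (hsum.sum_add_tsum_subtype_compl s).symm

theorem hasSum [CompleteSpace F] (hu : SeminormSummable u) : HasSum u hu.sum := by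
  rw [HasSum, SummationFilter.unconditional_filter, (schwartz_withSeminorms ℝ E F).tendsto_nhds]
  rintro ⟨k, l⟩ ε hε
  have htail := tendsto_tsum_compl_atTop_zero fun i => SchwartzMap.seminorm ℝ k l (u i)
  filter_upwards [htail.eventually (gt_mem_nhds hε)] with s hs
  rw [map_sub_rev, hu.sum_sub_finsetSum]
  exact (seminorm_sum_le _ k l).trans_lt hs

end SeminormSummable

theorem hasSum_schwartzMap_apply {u : ι → 𝓢(E, F)} {v : 𝓢(E, F)} (h : HasSum u v) (x : E) :
    HasSum (fun i => u i x) (v x) :=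
  (h.mapL (SchwartzMap.toBoundedContinuousFunctionCLM ℝ E F)).mapL
    (BoundedContinuousFunction.evalCLM ℝ x)

end SchwartzSeries

theorem one_add_norm_le_mul_one_add_norm_sub {E : Type*} [SeminormedAddCommGroup E] (a x : E) :
    1 + ‖a‖ ≤ (1 + ‖x‖) * (1 + ‖x - a‖) := by
  have htriangle : ‖a‖ ≤ ‖x‖ + ‖x - a‖ := norm_le_norm_add_norm_sub x a
  nlinarith [mul_nonneg (norm_nonneg x) (norm_nonneg (x - a))]

section Translation

variable {𝕜 E F : Type*} [RCLike 𝕜] [NormedAddCommGroup E] [NormedSpace ℝ E]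
  [NormedAddCommGroup F] [NormedSpace ℝ F]

theorem exists_one_add_norm_pow_mul_norm_iteratedFDeriv_le (u : 𝓢(E, F)) (k l : ℕ) :
    ∃ C : ℝ, 0 ≤ C ∧ ∀ x, (1 + ‖x‖) ^ k * ‖iteratedFDeriv ℝ l u x‖ ≤ C :=
  ⟨_, by positivity, fun x => SchwartzMap.one_add_le_sup_seminorm_apply (𝕜 := ℝ)
    (m := (k, l)) le_rfl le_rfl u x⟩

theorem exists_norm_le_mul_one_add_norm_pow_inv (u : 𝓢(E, F)) (N : ℕ) :
    ∃ C : ℝ, 0 ≤ C ∧ ∀ x, ‖u x‖ ≤ C * ((1 + ‖x‖) ^ N)⁻¹ := by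
  obtain ⟨C, hC, hu⟩ := exists_one_add_norm_pow_mul_norm_iteratedFDeriv_le u N 0
  refine ⟨C, hC, fun x => ?_⟩
  rw [← div_eq_mul_inv, le_div_iff₀' (by positivity)]
  simpa using hu x

theorem iteratedFDeriv_compSubConstCLM [NormedSpace 𝕜 F] (u : 𝓢(E, F)) (a : E) (l : ℕ) (x : E) :
    iteratedFDeriv ℝ l (SchwartzMap.compSubConstCLM 𝕜 a u) x = iteratedFDeriv ℝ l u (x - a) :=
  iteratedFDeriv_comp_sub l a x

theorem exists_seminorm_compSubConstCLM_le [NormedSpace 𝕜 F] (u : 𝓢(E, F)) (k l : ℕ) :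
    ∃ C : ℝ, ∀ a : E,
      SchwartzMap.seminorm ℝ k l (SchwartzMap.compSubConstCLM 𝕜 a u) ≤ C * (1 + ‖a‖) ^ k := by
  obtain ⟨C, hC, hu⟩ := exists_one_add_norm_pow_mul_norm_iteratedFDeriv_le u k l
  refine ⟨C, fun a => SchwartzMap.seminorm_le_bound ℝ k l _ (by positivity) fun x => ?_⟩
  have hx : ‖x‖ ≤ (1 + ‖a‖) * (1 + ‖x - a‖) := by
    linarith [norm_sub_rev a x ▸ one_add_norm_le_mul_one_add_norm_sub x a]
  calc ‖x‖ ^ k * ‖iteratedFDeriv ℝ l (SchwartzMap.compSubConstCLM 𝕜 a u) x‖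
      ≤ ((1 + ‖a‖) * (1 + ‖x - a‖)) ^ k * ‖iteratedFDeriv ℝ l u (x - a)‖ := by
        rw [iteratedFDeriv_compSubConstCLM]
        gcongr
    _ = (1 + ‖a‖) ^ k * ((1 + ‖x - a‖) ^ k * ‖iteratedFDeriv ℝ l u (x - a)‖) := by
        rw [mul_pow, mul_assoc]
    _ ≤ (1 + ‖a‖) ^ k * C := by
        gcongr
        exact hu _
    _ = C * (1 + ‖a‖) ^ k := mul_comm _ _

theorem exists_norm_iteratedFDeriv_mul_norm_iteratedFDeriv_sub_le {G : Type*}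
    [NormedAddCommGroup G] [NormedSpace ℝ G] (u : 𝓢(E, F)) (v : 𝓢(E, G)) (N k i j : ℕ) :
    ∃ C : ℝ, 0 ≤ C ∧ ∀ a x : E,
      ‖x‖ ^ k * (‖iteratedFDeriv ℝ i u x‖ * ‖iteratedFDeriv ℝ j v (x - a)‖) ≤
        C * ((1 + ‖a‖) ^ N)⁻¹ := by
  obtain ⟨A, hA, hu⟩ := exists_one_add_norm_pow_mul_norm_iteratedFDeriv_le u (k + N) i
  obtain ⟨B, hB, hv⟩ := exists_one_add_norm_pow_mul_norm_iteratedFDeriv_le v N j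
  refine ⟨A * B, by positivity, fun a x => ?_⟩
  rw [← div_eq_mul_inv, le_div_iff₀ (by positivity)]
  calc ‖x‖ ^ k * (‖iteratedFDeriv ℝ i u x‖ * ‖iteratedFDeriv ℝ j v (x - a)‖) * (1 + ‖a‖) ^ N
      ≤ (1 + ‖x‖) ^ k * (‖iteratedFDeriv ℝ i u x‖ * ‖iteratedFDeriv ℝ j v (x - a)‖) *
          ((1 + ‖x‖) * (1 + ‖x - a‖)) ^ N := by
        gcongr
        · exact le_add_of_nonneg_left zero_le_one
        · exact one_add_norm_le_mul_one_add_norm_sub a x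
    _ = ((1 + ‖x‖) ^ (k + N) * ‖iteratedFDeriv ℝ i u x‖) *
          ((1 + ‖x - a‖) ^ N * ‖iteratedFDeriv ℝ j v (x - a)‖) := by
        rw [mul_pow]
        ring
    _ ≤ A * B := by
        gcongr
        exacts [hu x, hv _]

theorem exists_seminorm_smulLeftCLM_compSubConstCLM_le [NormedSpace 𝕜 F] (u : 𝓢(E, 𝕜))
    (v : 𝓢(E, F)) (N k l : ℕ) :
    ∃ C : ℝ, 0 ≤ C ∧ ∀ a : E, SchwartzMap.seminorm ℝ k l
      (SchwartzMap.smulLeftCLM F u (SchwartzMap.compSubConstCLM 𝕜 a v)) ≤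
        C * ((1 + ‖a‖) ^ N)⁻¹ := by
  choose C hC hle using fun i =>
    exists_norm_iteratedFDeriv_mul_norm_iteratedFDeriv_sub_le u v N k i (l - i)
  have hsum : 0 ≤ ∑ i ∈ Finset.range (l + 1), (l.choose i : ℝ) * C i :=
    Finset.sum_nonneg fun i _ => mul_nonneg (by positivity) (hC i)
  refine ⟨_, hsum, fun a => SchwartzMap.seminorm_le_bound ℝ k l _ (by positivity) fun x => ?_⟩
  have hprod : ⇑(SchwartzMap.smulLeftCLM F u (SchwartzMap.compSubConstCLM 𝕜 a v)) =
      fun y => u y • SchwartzMap.compSubConstCLM 𝕜 a v y :=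
    funext fun y => SchwartzMap.smulLeftCLM_apply_apply u.hasTemperateGrowth _ y
  calc _ ≤ ‖x‖ ^ k * ∑ i ∈ Finset.range (l + 1), (l.choose i : ℝ) * ‖iteratedFDeriv ℝ i u x‖ *
          ‖iteratedFDeriv ℝ (l - i) (SchwartzMap.compSubConstCLM 𝕜 a v) x‖ := by
        rw [hprod]
        gcongr
        exact norm_iteratedFDeriv_smul_le (u.smooth l) (SchwartzMap.smooth _ l) x le_rfl
    _ = ∑ i ∈ Finset.range (l + 1), (l.choose i : ℝ) * (‖x‖ ^ k *
          (‖iteratedFDeriv ℝ i u x‖ * ‖iteratedFDeriv ℝ (l - i) v (x - a)‖)) := by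
        rw [Finset.mul_sum]
        refine Finset.sum_congr rfl fun i _ => ?_
        rw [iteratedFDeriv_compSubConstCLM]
        ring
    _ ≤ ∑ i ∈ Finset.range (l + 1), (l.choose i : ℝ) * (C i * ((1 + ‖a‖) ^ N)⁻¹) := by
        exact Finset.sum_le_sum fun i _ => mul_le_mul_of_nonneg_left (hle i a x) (by positivity)
    _ = (∑ i ∈ Finset.range (l + 1), (l.choose i : ℝ) * C i) * ((1 + ‖a‖) ^ N)⁻¹ := by
        simp only [Finset.sum_mul, mul_assoc]

end Translation

section Lattice

variable {n : ℕ}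

theorem latticePoint_apply (α : Fin n → ℤ) (j : Fin n) : latticePoint α j = (α j : ℝ) := rfl

theorem latticePoint_add (α β : Fin n → ℤ) :
    latticePoint (α + β) = latticePoint α + latticePoint β := by
  ext j; simp [latticePoint_apply]

theorem latticePoint_neg (α : Fin n → ℤ) : latticePoint (-α) = -latticePoint α := by
  ext j; simp [latticePoint_apply]

theorem latticePoint_sub (α β : Fin n → ℤ) :
    latticePoint (α - β) = latticePoint α - latticePoint β := by
  rw [sub_eq_add_neg, latticePoint_add, latticePoint_neg, sub_eq_add_neg]

theorem latticePoint_eq_sum_single (α : Fin n → ℤ) :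
    latticePoint α = ∑ j, α j • EuclideanSpace.single j (1 : ℝ) := by
  ext i
  simp [latticePoint_apply, Finset.sum_apply, Pi.single_apply]

theorem latticePoint_injective : Function.Injective (latticePoint (n := n)) := fun α β h =>
  funext fun j => by simpa [latticePoint_apply] using congrArg (fun v : Rn n => v j) h

theorem one_le_norm_latticePoint {α : Fin n → ℤ} (hα : α ≠ 0) : 1 ≤ ‖latticePoint α‖ := by
  obtain ⟨j, hj⟩ := Function.ne_iff.mp hα
  calc (1 : ℝ) ≤ |(α j : ℝ)| := by exact_mod_cast Int.one_le_abs hj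
    _ = ‖latticePoint α j‖ := rfl
    _ ≤ ‖latticePoint α‖ := PiLp.norm_apply_le _ _

theorem summable_one_add_norm_latticePoint_pow_inv :
    Summable fun α : Fin n → ℤ => ((1 + ‖latticePoint α‖) ^ (n + 1))⁻¹ := by
  let L := Submodule.span ℤ (Set.range (EuclideanSpace.basisFun (Fin n) ℝ).toBasis)
  have hrank : Module.finrank ℤ L < n + 1 := by simp [ZLattice.rank ℝ L]
  have hmem (α : Fin n → ℤ) : latticePoint α ∈ L := by
    rw [latticePoint_eq_sum_single]
    exact L.sum_mem fun j _ => L.smul_mem _ (Submodule.subset_span ⟨j, by simp⟩)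
  have hsum := (ZLattice.summable_norm_pow_inv L (n + 1) hrank).comp_injective
    (i := fun α : Fin n → ℤ => (⟨latticePoint α, hmem α⟩ : L))
    fun α β h => latticePoint_injective (congrArg Subtype.val h)
  refine hsum.of_norm_bounded_eventually ?_
  filter_upwards [(Set.finite_singleton (0 : Fin n → ℤ)).compl_mem_cofinite] with α hα
  have hpos : 0 < ‖latticePoint α‖ := zero_lt_one.trans_le (one_le_norm_latticePoint hα)
  rw [Real.norm_of_nonneg (by positivity), Function.comp_apply, inv_pow]
  gcongr
  exact le_add_of_nonneg_left zero_le_one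

theorem norm_latticePoint_le_norm_two_pi_smul (α : Fin n → ℤ) :
    ‖latticePoint α‖ ≤ ‖(2 * π) • latticePoint α‖ := by
  rw [norm_smul, Real.norm_of_nonneg (by positivity)]
  exact le_mul_of_one_le_left (norm_nonneg _) (by linarith [Real.pi_gt_three])

theorem exists_norm_sub_latticePoint_le (ξ : Rn n) :
    ∃ β : Fin n → ℤ, ‖ξ - latticePoint β‖ ≤ √n := by
  refine ⟨fun j => ⌊ξ j⌋, ?_⟩
  have hcoord (j : Fin n) : ‖(ξ - latticePoint fun j => ⌊ξ j⌋) j‖ ^ 2 ≤ 1 := by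
    rw [PiLp.sub_apply, latticePoint_apply, ← Int.fract, Real.norm_of_nonneg (Int.fract_nonneg _)]
    exact pow_le_one₀ (Int.fract_nonneg _) (Int.fract_lt_one _).le
  rw [EuclideanSpace.norm_eq]
  exact Real.sqrt_le_sqrt ((Finset.sum_le_sum fun j _ => hcoord j).trans_eq (by simp))

theorem pairwise_disjoint_ball_latticePoint_add (η : Rn n) {r : ℝ} (hr : r ≤ 1 / 2) :
    Pairwise (Function.onFun Disjoint fun α : Fin n → ℤ =>
      Metric.ball (latticePoint α + η) r) := fun α β h => by
  refine Metric.ball_disjoint_ball ?_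
  rw [dist_add_right, dist_eq_norm, ← latticePoint_sub]
  linarith [one_le_norm_latticePoint (sub_ne_zero.mpr h)]

end Lattice

section AngularFourier

variable {n : ℕ}

/-- Dilation by `(2π)⁻¹`, as a linear automorphism of `ℝⁿ`. -/
noncomputable def invTwoPiDilation (n : ℕ) : Rn n ≃L[ℝ] Rn n :=
  ContinuousLinearEquiv.smulLeft (Units.mk0 (2 * π)⁻¹ (by positivity))

/-- The Fourier transform `ψ̂(ξ) = ∫ ψ(x) e^{-i x·ξ} dx` on Schwartz space. It differs from
Mathlib's `𝓕`, which has the phase `e^{-2πi x·ξ}`, by a dilation. -/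
noncomputable def angularFourier : 𝓢(Rn n, ℂ) ≃L[ℂ] 𝓢(Rn n, ℂ) :=
  (FourierTransform.fourierCLE ℂ 𝓢(Rn n, ℂ)).trans <|
    .equivOfInverse (SchwartzMap.compCLMOfContinuousLinearEquiv ℂ (invTwoPiDilation n))
      (SchwartzMap.compCLMOfContinuousLinearEquiv ℂ (invTwoPiDilation n).symm)
      (fun ψ => by ext; simp) (fun ψ => by ext; simp)

theorem angularFourier_apply (ψ : 𝓢(Rn n, ℂ)) (ξ : Rn n) :
    angularFourier ψ ξ = ∫ x, ψ x * planeWave (-ξ) x := by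
  change 𝓕 ψ ((2 * π)⁻¹ • ξ) = _
  rw [SchwartzMap.fourier_coe, Real.fourier_eq']
  congr with x
  rw [smul_eq_mul, mul_comm, planeWave, real_inner_smul_right, inner_neg_left, real_inner_comm]
  congr 4
  field_simp

theorem planeWave_add (ξ η x : Rn n) :
    planeWave (ξ + η) x = planeWave ξ x * planeWave η x := by
  simp only [planeWave, inner_add_left, ofReal_add, add_mul, Complex.exp_add]

theorem planeWave_apply_add (ξ x y : Rn n) :
    planeWave ξ (x + y) = planeWave ξ x * planeWave ξ y := by
  simp only [planeWave, inner_add_right, ofReal_add, add_mul, Complex.exp_add]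

theorem norm_planeWave (ξ x : Rn n) : ‖planeWave ξ x‖ = 1 := norm_exp_ofReal_mul_I _

theorem continuous_planeWave (ξ : Rn n) : Continuous (planeWave ξ) := by
  unfold planeWave
  fun_prop

theorem demodulate_apply_planeWave (ξ : Rn n) (ψ : 𝓢(Rn n, ℂ)) (x : Rn n) :
    demodulate ξ ψ x = ψ x * planeWave (-ξ) x := by
  rw [demodulate_apply, planeWave, inner_neg_left, ofReal_neg, neg_mul]

theorem angularFourier_demodulate (ξ : Rn n) (ψ : 𝓢(Rn n, ℂ)) :
    angularFourier (demodulate ξ ψ) =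
      SchwartzMap.compSubConstCLM ℂ (-ξ) (angularFourier ψ) := by
  ext η
  simp only [SchwartzMap.compSubConstCLM_apply, angularFourier_apply, demodulate_apply_planeWave,
    mul_assoc, ← planeWave_add]
  congr! 4
  abel

theorem angularFourier_compSubConstCLM (x : Rn n) (ψ : 𝓢(Rn n, ℂ)) (ξ : Rn n) :
    angularFourier (SchwartzMap.compSubConstCLM ℂ x ψ) ξ =
      angularFourier ψ ξ * planeWave (-ξ) x := by
  rw [angularFourier_apply, ← integral_add_right_eq_self _ x, angularFourier_apply,
    ← integral_mul_const]
  simp only [SchwartzMap.compSubConstCLM_apply, add_sub_cancel_right, planeWave_apply_add,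
    mul_assoc]

theorem character_eq_angularFourier (α : Fin n → ℤ) (ψ : 𝓢(Rn n, ℂ)) :
    character α ψ = angularFourier ψ (-latticePoint α) := by
  rw [angularFourier_apply, neg_neg, character_apply]
  rfl

theorem exists_norm_character_le (ψ : 𝓢(Rn n, ℂ)) (N : ℕ) :
    ∃ C : ℝ, 0 ≤ C ∧ ∀ α, ‖character α ψ‖ ≤ C * ((1 + ‖latticePoint α‖) ^ N)⁻¹ := by
  obtain ⟨C, hC, hdecay⟩ := exists_norm_le_mul_one_add_norm_pow_inv (angularFourier ψ) N
  refine ⟨C, hC, fun α => ?_⟩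
  simpa only [character_eq_angularFourier, norm_neg] using hdecay (-latticePoint α)

theorem summable_norm_character (ψ : 𝓢(Rn n, ℂ)) : Summable fun α => ‖character α ψ‖ := by
  obtain ⟨C, -, hdecay⟩ := exists_norm_character_le ψ (n + 1)
  exact (summable_one_add_norm_latticePoint_pow_inv.mul_left C).of_nonneg_of_le
    (fun _ => norm_nonneg _) hdecay

end AngularFourier

section UnitCube

variable {n : ℕ}

theorem pairwise_disjoint_pi_Ioc_intCast :
    Pairwise (Function.onFun Disjoint fun β : Fin n → ℤ =>
      Set.univ.pi fun j => Set.Ioc (β j : ℝ) (β j + 1)) := fun α β h => by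
  obtain ⟨j, hj⟩ := Function.ne_iff.mp h
  exact Set.disjoint_univ_pi.mpr ⟨j, Set.pairwise_disjoint_Ioc_intCast ℝ hj⟩

theorem iUnion_pi_Ioc_intCast :
    ⋃ β : Fin n → ℤ, Set.univ.pi (fun j => Set.Ioc (β j : ℝ) (β j + 1)) = Set.univ := by
  rw [Set.iUnion_univ_pi fun (_ : Fin n) (k : ℤ) => Set.Ioc (k : ℝ) (k + 1)]
  simp only [iUnion_Ioc_intCast, Set.pi_univ]

variable {G : Type*} [NormedAddCommGroup G] [NormedSpace ℝ G]

theorem setIntegral_pi_Ioc_intCast (W : (Fin n → ℝ) → G) (β : Fin n → ℤ) :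
    ∫ t in Set.univ.pi fun j => Set.Ioc (β j : ℝ) (β j + 1), W t =
      ∫ t in Set.univ.pi fun _ => Set.Ioc (0 : ℝ) 1, W (t + fun j => (β j : ℝ)) := by
  rw [← (measurePreserving_add_right volume (fun j => (β j : ℝ))).setIntegral_preimage_emb
    (MeasurableEquiv.addRight _).measurableEmbedding]
  congr 2
  ext t
  simp [add_comm _ (1 : ℝ)]

theorem hasSum_setIntegral_pi_Ioc {W : (Fin n → ℝ) → G} (hW : Integrable W) :
    HasSum (fun β : Fin n → ℤ =>
      ∫ t in Set.univ.pi fun _ => Set.Ioc (0 : ℝ) 1, W (t + fun j => (β j : ℝ))) (∫ t, W t) := by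
  have h := hasSum_integral_iUnion (fun _ : Fin n → ℤ => MeasurableSet.univ_pi fun _ =>
    measurableSet_Ioc) pairwise_disjoint_pi_Ioc_intCast hW.integrableOn
  simpa only [iUnion_pi_Ioc_intCast, setIntegral_univ, setIntegral_pi_Ioc_intCast] using h

theorem setIntegral_pi_Ioc_tsum {W : (Fin n → ℝ) → G} (hW : Integrable W) :
    ∫ t in Set.univ.pi fun _ => Set.Ioc (0 : ℝ) 1, ∑' β : Fin n → ℤ, W (t + fun j => (β j : ℝ)) =
      ∫ t, W t :=
  (hasSum_integral_of_summable_integral_norm (fun _ => (hW.comp_add_right _).integrableOn)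
    (hasSum_setIntegral_pi_Ioc hW.norm).summable).unique (hasSum_setIntegral_pi_Ioc hW)

end UnitCube

section Poisson

variable {n : ℕ}

/-- The projection of `ℝⁿ` onto `ℝⁿ / 2πℤⁿ`, with the quotient rescaled to Mathlib's torus
`ℝⁿ / ℤⁿ`. -/
noncomputable def torusProj (x : Rn n) : UnitAddTorus (Fin n) :=
  fun j => ((invTwoPiDilation n x j : ℝ) : UnitAddCircle)

theorem torusProj_two_pi_smul (t : Fin n → ℝ) :
    torusProj ((2 * π) • WithLp.toLp 2 t) = fun j => (t j : UnitAddCircle) := by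
  have h : invTwoPiDilation n ((2 * π) • WithLp.toLp 2 t) = WithLp.toLp 2 t :=
    inv_smul_smul₀ Real.two_pi_pos.ne' _
  ext j
  rw [torusProj, h]

theorem isOpenQuotientMap_torusProj : IsOpenQuotientMap (torusProj (n := n)) :=
  (IsOpenQuotientMap.piMap fun _ => QuotientAddGroup.isOpenQuotientMap_mk).comp
    ((EuclideanSpace.equiv (Fin n) ℝ).toHomeomorph.isOpenQuotientMap.comp
      (invTwoPiDilation n).toHomeomorph.isOpenQuotientMap)

theorem exists_eq_add_of_torusProj_eq {x y : Rn n} (h : torusProj x = torusProj y) :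
    ∃ γ : Fin n → ℤ, x = y + (2 * π) • latticePoint γ := by
  have hcoord (j : Fin n) : ∃ m : ℤ, (m : ℝ) = (2 * π)⁻¹ * (x j - y j) := by
    have hj : ((invTwoPiDilation n x j - invTwoPiDilation n y j : ℝ) : UnitAddCircle) = 0 := by
      rw [AddCircle.coe_sub, sub_eq_zero]
      exact congrFun h j
    obtain ⟨m, hm⟩ := (AddCircle.coe_eq_zero_iff 1).mp hj
    exact ⟨m, by rw [mul_sub, ← zsmul_one, hm]; rfl⟩
  choose γ hγ using hcoord
  refine ⟨γ, PiLp.ext fun j => ?_⟩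
  rw [PiLp.add_apply, PiLp.smul_apply, latticePoint_apply, hγ, smul_eq_mul,
    mul_inv_cancel_left₀ (by positivity), add_sub_cancel]

theorem mFourier_torusProj (α : Fin n → ℤ) (x : Rn n) :
    UnitAddTorus.mFourier α (torusProj x) = planeWave (latticePoint α) x := by
  simp only [UnitAddTorus.mFourier, torusProj, ContinuousMap.coe_mk, fourier_coe_apply, planeWave,
    ← Complex.exp_sum, PiLp.inner_apply, ofReal_sum, Finset.sum_mul]
  congr! 2 with j
  have hscale : invTwoPiDilation n x j = (2 * π)⁻¹ * x j := rfl
  rw [hscale, latticePoint_apply, RCLike.inner_apply', conj_trivial]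
  push_cast
  field_simp

theorem planeWave_latticePoint_add_two_pi_smul (α β : Fin n → ℤ) (x : Rn n) :
    planeWave (latticePoint α) (x + (2 * π) • latticePoint β) = planeWave (latticePoint α) x := by
  have hone : planeWave (latticePoint α) ((2 * π) • latticePoint β) = 1 := by
    have hcoe (j : Fin n) : ((β j : ℝ) : UnitAddCircle) = 0 :=
      (AddCircle.coe_eq_zero_iff 1).mpr ⟨β j, zsmul_one _⟩
    rw [← mFourier_torusProj, latticePoint, torusProj_two_pi_smul]
    simp [UnitAddTorus.mFourier, hcoe]
  rw [planeWave_apply_add, hone, mul_one]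

theorem exists_norm_translate_le (ψ : 𝓢(Rn n, ℂ)) :
    ∃ C : ℝ, 0 ≤ C ∧ ∀ (x : Rn n) (β : Fin n → ℤ), ‖ψ (x + (2 * π) • latticePoint β)‖ ≤
      C * (1 + ‖x‖) ^ (n + 1) * ((1 + ‖latticePoint β‖) ^ (n + 1))⁻¹ := by
  obtain ⟨C, hC, hdecay⟩ := exists_norm_le_mul_one_add_norm_pow_inv ψ (n + 1)
  refine ⟨C, hC, fun x β => (hdecay _).trans ?_⟩
  have hβ : 1 + ‖latticePoint β‖ ≤ (1 + ‖x‖) * (1 + ‖x + (2 * π) • latticePoint β‖) := by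
    refine (add_le_add_right (norm_latticePoint_le_norm_two_pi_smul β) 1).trans ?_
    simpa using one_add_norm_le_mul_one_add_norm_sub (-((2 * π) • latticePoint β)) x
  calc C * ((1 + ‖x + (2 * π) • latticePoint β‖) ^ (n + 1))⁻¹
      = C * (1 + ‖x‖) ^ (n + 1) *
          (((1 + ‖x‖) * (1 + ‖x + (2 * π) • latticePoint β‖)) ^ (n + 1))⁻¹ := by
        rw [mul_pow, mul_inv, mul_assoc C, mul_inv_cancel_left₀ (by positivity)]
    _ ≤ C * (1 + ‖x‖) ^ (n + 1) * ((1 + ‖latticePoint β‖) ^ (n + 1))⁻¹ := by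
        gcongr

/-- The sum of the translates of `ψ` by the period lattice `2πℤⁿ`. -/
noncomputable def periodization (ψ : 𝓢(Rn n, ℂ)) (x : Rn n) : ℂ :=
  ∑' β : Fin n → ℤ, ψ (x + (2 * π) • latticePoint β)

theorem periodization_eq_tsum_sub (ψ : 𝓢(Rn n, ℂ)) (x : Rn n) :
    periodization ψ x = ∑' β : Fin n → ℤ, ψ (x - (2 * π) • latticePoint β) := by
  rw [periodization, ← (Equiv.neg (Fin n → ℤ)).tsum_eq]
  simp only [Equiv.neg_apply, latticePoint_neg, smul_neg, sub_eq_add_neg]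

theorem periodization_add (ψ : 𝓢(Rn n, ℂ)) (x : Rn n) (γ : Fin n → ℤ) :
    periodization ψ (x + (2 * π) • latticePoint γ) = periodization ψ x := by
  rw [periodization, periodization,
    ← (Equiv.addLeft γ).tsum_eq fun β => ψ (x + (2 * π) • latticePoint β)]
  simp only [Equiv.coe_addLeft, latticePoint_add, smul_add, add_assoc]

theorem continuous_periodization (ψ : 𝓢(Rn n, ℂ)) : Continuous (periodization ψ) := by
  obtain ⟨C, hC, hdecay⟩ := exists_norm_translate_le ψ
  refine continuous_iff_continuousAt.mpr fun x₀ => ?_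
  refine ContinuousOn.continuousAt (s := Metric.ball 0 (‖x₀‖ + 1)) ?_
    (Metric.isOpen_ball.mem_nhds (by simp))
  refine continuousOn_tsum (fun β => ?_) (summable_one_add_norm_latticePoint_pow_inv.mul_left
    (C * (1 + (‖x₀‖ + 1)) ^ (n + 1))) fun β x hx => (hdecay x β).trans ?_
  · exact (ψ.continuous.comp (continuous_id.add continuous_const)).continuousOn
  · have hx' : ‖x‖ ≤ ‖x₀‖ + 1 := (mem_ball_zero_iff.mp hx).le
    gcongr

theorem exists_continuousMap_torusProj (ψ : 𝓢(Rn n, ℂ)) :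
    ∃ G : C(UnitAddTorus (Fin n), ℂ), ∀ x, G (torusProj x) = periodization ψ x := by
  let proj : C(Rn n, UnitAddTorus (Fin n)) := ⟨torusProj, isOpenQuotientMap_torusProj.continuous⟩
  have hproj : Topology.IsQuotientMap proj := isOpenQuotientMap_torusProj.isQuotientMap
  let P : C(Rn n, ℂ) := ⟨periodization ψ, continuous_periodization ψ⟩
  have hfactors : Function.FactorsThrough P proj := fun x y h => by
    obtain ⟨γ, rfl⟩ := exists_eq_add_of_torusProj_eq h
    exact periodization_add ψ y γ
  exact ⟨hproj.lift P hfactors, fun x => DFunLike.congr_fun (hproj.lift_comp P hfactors) x⟩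

theorem setIntegral_pi_Ioc_tsum_two_pi_smul {G : Type*} [NormedAddCommGroup G] [NormedSpace ℝ G]
    {W : Rn n → G} (hW : Integrable W) :
    ∫ t in Set.univ.pi fun _ => Set.Ioc (0 : ℝ) 1, ∑' β : Fin n → ℤ,
      W ((2 * π) • WithLp.toLp 2 t + (2 * π) • latticePoint β) = ((2 * π) ^ n)⁻¹ • ∫ x, W x := by
  have htoLp := PiLp.volume_preserving_toLp (Fin n)
  have hemb := (MeasurableEquiv.toLp 2 (Fin n → ℝ)).measurableEmbedding
  have hdilate := (htoLp.integrable_comp_emb hemb).mpr (hW.comp_smul Real.two_pi_pos.ne')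
  calc _ = ∫ t : Fin n → ℝ, W ((2 * π) • WithLp.toLp 2 t) := by
        simp only [← smul_add]
        exact setIntegral_pi_Ioc_tsum hdilate
    _ = ∫ x, W ((2 * π) • x) := htoLp.integral_comp hemb fun x => W ((2 * π) • x)
    _ = ((2 * π) ^ n)⁻¹ • ∫ x, W x := by
        rw [Measure.integral_comp_smul_of_nonneg _ _ _ (hR := Real.two_pi_pos.le),
          finrank_euclideanSpace_fin]

theorem mFourierCoeff_of_comp_torusProj {ψ : 𝓢(Rn n, ℂ)} {G : UnitAddTorus (Fin n) → ℂ}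
    (hG : ∀ x, G (torusProj x) = periodization ψ x) (α : Fin n → ℤ) :
    UnitAddTorus.mFourierCoeff G (-α) = (((2 * π) ^ n)⁻¹ : ℝ) * character α ψ := by
  have hW : Integrable fun x => ψ x * planeWave (latticePoint α) x :=
    ψ.integrable.mul_bdd (c := 1) (continuous_planeWave _).aestronglyMeasurable
      (.of_forall fun x => (norm_planeWave _ x).le)
  have hcube : {t : Fin n → ℝ | ∀ j, t j ∈ Set.Ioc ((0 : Fin n → ℝ) j) ((0 : Fin n → ℝ) j + 1)} =
      Set.univ.pi fun _ => Set.Ioc (0 : ℝ) 1 := by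
    ext; simp
  rw [UnitAddTorus.mFourierCoeff_eq_integral G (-α) 0, neg_neg, hcube]
  refine Eq.trans ?_ (setIntegral_pi_Ioc_tsum_two_pi_smul
    (W := fun x => ψ x * planeWave (latticePoint α) x) hW)
  congr with t
  rw [← torusProj_two_pi_smul, mFourier_torusProj, hG, periodization, smul_eq_mul,
    mul_comm (planeWave _ _), ← tsum_mul_right]
  simp only [planeWave_latticePoint_add_two_pi_smul]

theorem hasSum_character_mul_planeWave (ψ : 𝓢(Rn n, ℂ)) (x : Rn n) :
    HasSum (fun α : Fin n → ℤ => ((((2 * π) ^ n)⁻¹ : ℝ) : ℂ) * character α ψ *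
      planeWave (-latticePoint α) x) (periodization ψ x) := by
  obtain ⟨G, hG⟩ := exists_continuousMap_torusProj ψ
  have hcoeff : Summable (UnitAddTorus.mFourierCoeff G) := by
    rw [← (Equiv.neg (Fin n → ℤ)).summable_iff]
    refine .of_norm ?_
    simp only [Function.comp_def, Equiv.neg_apply, mFourierCoeff_of_comp_torusProj hG, norm_mul]
    exact (summable_norm_character ψ).mul_left _
  have h := UnitAddTorus.hasSum_mFourier_series_apply_of_summable hcoeff (torusProj x)
  rw [hG, ← (Equiv.neg (Fin n → ℤ)).hasSum_iff] at h
  simpa only [Function.comp_def, Equiv.neg_apply, mFourierCoeff_of_comp_torusProj hG,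
    mFourier_torusProj, latticePoint_neg, smul_eq_mul] using h

theorem mFourierCoeff_one (α : Fin n → ℤ) :
    UnitAddTorus.mFourierCoeff (fun _ : UnitAddTorus (Fin n) => (1 : ℂ)) α =
      if α = 0 then 1 else 0 := by
  have h := UnitAddTorus.mFourierBasis_repr (UnitAddTorus.mFourierLp 2 (0 : Fin n → ℤ)) α
  rw [UnitAddTorus.mFourierCoeff_toLp, UnitAddTorus.mFourier_zero,
    ← UnitAddTorus.coe_mFourierBasis, HilbertBasis.repr_self, lp.single_apply] at h
  refine h.symm.trans ?_
  simp only [Pi.single_apply]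

theorem IsPeriodicPartition.character_eq {φ : 𝓢(Rn n, ℂ)} (hφ : IsPeriodicPartition φ)
    (α : Fin n → ℤ) : character α φ = if α = 0 then (2 * π : ℂ) ^ n else 0 := by
  have hone (x : Rn n) : 1 = periodization φ x :=
    (periodization_eq_tsum_sub φ x).trans (hφ x).tsum_eq |>.symm
  have h := mFourierCoeff_of_comp_torusProj (G := fun _ => 1) hone α
  rw [mFourierCoeff_one, ofReal_inv, eq_inv_mul_iff_mul_eq₀ (by simp)] at h
  rw [← h]
  simp

end Poisson

section PeriodicDistribution

variable {n : ℕ}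

theorem seminormSummable_smul_compSubConstCLM (ψ : 𝓢(Rn n, ℂ)) {a : (Fin n → ℤ) → ℂ}
    (ha : ∀ N : ℕ, ∃ C : ℝ, 0 ≤ C ∧ ∀ α, ‖a α‖ ≤ C * ((1 + ‖latticePoint α‖) ^ N)⁻¹) :
    SeminormSummable fun α =>
      a α • SchwartzMap.compSubConstCLM ℂ (-latticePoint α) ψ := fun k l => by
  obtain ⟨C, hC, hCa⟩ := ha (k + (n + 1))
  obtain ⟨D, hDψ⟩ := exists_seminorm_compSubConstCLM_le (𝕜 := ℂ) ψ k l
  refine (summable_one_add_norm_latticePoint_pow_inv.mul_left (C * D)).of_nonneg_of_le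
    (fun _ => apply_nonneg _ _) fun α => ?_
  calc SchwartzMap.seminorm ℝ k l (a α • SchwartzMap.compSubConstCLM ℂ (-latticePoint α) ψ)
      = ‖a α‖ * SchwartzMap.seminorm ℝ k l
          (SchwartzMap.compSubConstCLM ℂ (-latticePoint α) ψ) :=
        map_smul_eq_mul (SchwartzMap.seminorm ℂ k l) _ _
    _ ≤ C * ((1 + ‖latticePoint α‖) ^ (k + (n + 1)))⁻¹ *
          (D * (1 + ‖latticePoint α‖) ^ k) := by
        gcongr
        · exact hCa α
        · simpa only [norm_neg] using hDψ (-latticePoint α)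
    _ = C * D * ((1 + ‖latticePoint α‖) ^ (n + 1))⁻¹ := by
        rw [pow_add]
        field_simp

theorem exists_hasSum_smul_demodulate (φ : 𝓢(Rn n, ℂ)) {a : (Fin n → ℤ) → ℂ}
    (ha : ∀ N : ℕ, ∃ C : ℝ, 0 ≤ C ∧ ∀ α, ‖a α‖ ≤ C * ((1 + ‖latticePoint α‖) ^ N)⁻¹) :
    ∃ v : 𝓢(Rn n, ℂ), HasSum (fun α => a α • demodulate (latticePoint α) φ) v := by
  -- The Fourier transform turns modulations into translations, whose seminorms are easy to bound.
  have h := (seminormSummable_smul_compSubConstCLM (angularFourier φ) ha).hasSum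
  simp only [← angularFourier_demodulate, ← map_smul] at h
  exact ⟨_, angularFourier.hasSum.mp h⟩

theorem seminormSummable_smulLeftCLM_compSubConstCLM (u v : 𝓢(Rn n, ℂ)) :
    SeminormSummable fun β : Fin n → ℤ => SchwartzMap.smulLeftCLM ℂ u
      (SchwartzMap.compSubConstCLM ℂ ((2 * π) • latticePoint β) v) := fun k l => by
  obtain ⟨C, hC, h⟩ := exists_seminorm_smulLeftCLM_compSubConstCLM_le u v (n + 1) k l
  refine (summable_one_add_norm_latticePoint_pow_inv.mul_left C).of_nonneg_of_le
    (fun _ => apply_nonneg _ _) fun β => (h _).trans ?_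
  gcongr
  exact norm_latticePoint_le_norm_two_pi_smul β

theorem smulLeftCLM_compSubConstCLM_apply (u v : 𝓢(Rn n, ℂ)) (a x : Rn n) :
    SchwartzMap.smulLeftCLM ℂ u (SchwartzMap.compSubConstCLM ℂ a v) x = u x * v (x - a) := by
  rw [SchwartzMap.smulLeftCLM_apply_apply u.hasTemperateGrowth, SchwartzMap.compSubConstCLM_apply,
    smul_eq_mul]

theorem IsPeriodicPartition.hasSum_smulLeftCLM_compSubConstCLM {φ : 𝓢(Rn n, ℂ)}
    (hφ : IsPeriodicPartition φ) (ψ : 𝓢(Rn n, ℂ)) :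
    HasSum (fun β : Fin n → ℤ => SchwartzMap.smulLeftCLM ℂ ψ
      (SchwartzMap.compSubConstCLM ℂ ((2 * π) • latticePoint β) φ)) ψ := by
  have h := (seminormSummable_smulLeftCLM_compSubConstCLM ψ φ).hasSum
  convert h
  ext x
  refine HasSum.unique ?_ (hasSum_schwartzMap_apply h x)
  simpa only [smulLeftCLM_compSubConstCLM_apply, mul_one] using (hφ x).mul_left (ψ x)

theorem IsPeriodic.apply_compSubConstCLM {f : 𝓢'(Rn n, ℂ)} (hf : IsPeriodic f)
    (β : Fin n → ℤ) (ψ : 𝓢(Rn n, ℂ)) :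
    f (SchwartzMap.compSubConstCLM ℂ ((2 * π) • latticePoint β) ψ) = f ψ := by
  let periods : AddSubgroup (Rn n) :=
    { carrier := {a | ∀ ψ : 𝓢(Rn n, ℂ), f (SchwartzMap.compSubConstCLM ℂ a ψ) = f ψ}
      zero_mem' := fun ψ => by simp
      add_mem' := fun {a b} ha hb ψ => by
        rw [← SchwartzMap.compSubConstCLM_comp, hb, ha]
      neg_mem' := fun {a} ha ψ => by
        have h := ha (SchwartzMap.compSubConstCLM ℂ (-a) ψ)
        rw [SchwartzMap.compSubConstCLM_comp, neg_add_cancel] at h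
        simpa using h.symm }
  have hmem : (2 * π) • latticePoint β ∈ periods := by
    have hsum : (2 * π) • latticePoint β = ∑ j, β j • EuclideanSpace.single j (2 * π) := by
      ext i
      simp [latticePoint_apply, Finset.sum_apply, Pi.single_apply, mul_comm]
    rw [hsum]
    exact periods.sum_mem fun j _ => periods.zsmul_mem (hf j) _
  exact hmem ψ

theorem hasSum_temperedDistribution_apply (f : 𝓢'(Rn n, ℂ)) {ι : Type*} {u : ι → 𝓢(Rn n, ℂ)}
    {v : 𝓢(Rn n, ℂ)} (h : HasSum u v) : HasSum (fun i => f (u i)) (f v) :=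
  h.map f (map_continuous f)

theorem IsPeriodic.hasSum_localized {f : 𝓢'(Rn n, ℂ)} (hf : IsPeriodic f) {φ : 𝓢(Rn n, ℂ)}
    (hφ : IsPeriodicPartition φ) (ψ : 𝓢(Rn n, ℂ)) :
    HasSum (fun β : Fin n → ℤ => f (SchwartzMap.smulLeftCLM ℂ φ
      (SchwartzMap.compSubConstCLM ℂ ((2 * π) • latticePoint β) ψ))) (f ψ) := by
  have h := hasSum_temperedDistribution_apply f (hφ.hasSum_smulLeftCLM_compSubConstCLM ψ)
  rw [← (Equiv.neg (Fin n → ℤ)).hasSum_iff] at h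
  convert! h using 2 with β
  rw [Function.comp_apply, Equiv.neg_apply]
  refine (hf.apply_compSubConstCLM (-β) _).symm.trans (congrArg f ?_)
  ext x
  rw [smulLeftCLM_compSubConstCLM_apply, SchwartzMap.compSubConstCLM_apply,
    smulLeftCLM_compSubConstCLM_apply]
  simp [latticePoint_neg, mul_comm]

theorem IsPeriodic.hasSum_fourierCoefficient_apply {f : 𝓢'(Rn n, ℂ)} (hf : IsPeriodic f)
    {φ : 𝓢(Rn n, ℂ)} (hφ : IsPeriodicPartition φ) (ψ : 𝓢(Rn n, ℂ)) :
    HasSum (fun α : Fin n → ℤ => fourierCoefficient φ f α * character α ψ) (f ψ) := by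
  obtain ⟨v, hv⟩ := exists_hasSum_smul_demodulate φ
    (a := fun α => ((((2 * π) ^ n)⁻¹ : ℝ) : ℂ) * character α ψ) fun N => by
      obtain ⟨C, hC, h⟩ := exists_norm_character_le ψ N
      refine ⟨((2 * π) ^ n)⁻¹ * C, by positivity, fun α => ?_⟩
      rw [norm_mul, norm_real, Real.norm_of_nonneg (by positivity), mul_assoc]
      gcongr
      exact h α
  have hw := (seminormSummable_smulLeftCLM_compSubConstCLM φ ψ).hasSum
  have hpoisson : v = (seminormSummable_smulLeftCLM_compSubConstCLM φ ψ).sum := by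
    ext x
    have hleft := hasSum_schwartzMap_apply hv x
    have hright := hasSum_schwartzMap_apply hw x
    have h := (hasSum_character_mul_planeWave ψ x).mul_left (φ x)
    simp only [smulLeftCLM_compSubConstCLM_apply] at hright
    rw [← hright.tsum_eq, tsum_mul_left, ← periodization_eq_tsum_sub]
    refine hleft.unique ?_
    convert! h using 2 with α
    rw [smul_apply, demodulate_apply_planeWave, smul_eq_mul, mul_left_comm]
  have hpair := hasSum_temperedDistribution_apply f hv
  rw [hpoisson, (hasSum_temperedDistribution_apply f hw).unique (hf.hasSum_localized hφ ψ)] at hpair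
  convert! hpair using 2 with α
  rw [map_smul, smul_eq_mul, fourierCoefficient, mul_right_comm]

theorem IsPeriodic.hasSum_fourierCoefficient_smul_character {f : 𝓢'(Rn n, ℂ)}
    (hf : IsPeriodic f) {φ : 𝓢(Rn n, ℂ)} (hφ : IsPeriodicPartition φ) :
    HasSum (fun α : Fin n → ℤ => fourierCoefficient φ f α • character α) f := by
  rw [HasSum, PointwiseConvergenceCLM.tendsto_iff_forall_tendsto]
  intro ψ
  refine (hf.hasSum_fourierCoefficient_apply hφ ψ).congr fun s => ?_
  rw [sum_apply]
  rfl

end PeriodicDistribution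

section Weight

variable {n : ℕ}

theorem weight_pos (s : ℝ) (x : Rn n) : 0 < weight s x := Real.rpow_pos_of_pos (by positivity) _

theorem norm_weight (s : ℝ) (x : Rn n) : ‖(weight s x : ℂ)‖ = weight s x := by
  rw [norm_real, Real.norm_of_nonneg (weight_pos s x).le]

theorem weight_neg (s : ℝ) (x : Rn n) : weight (-s) x = (weight s x)⁻¹ := by
  rw [weight, neg_div, Real.rpow_neg (by positivity), weight]

theorem weight_apply_neg (s : ℝ) (x : Rn n) : weight s (-x) = weight s x := by
  simp only [weight, norm_neg]

theorem continuous_weight (s : ℝ) : Continuous (weight s : Rn n → ℝ) :=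
  Continuous.rpow_const (by fun_prop) fun x => Or.inl (by positivity)

theorem weight_le_two_rpow_mul {s : ℝ} (hs : 0 ≤ s) (x y : Rn n) :
    weight s x ≤ 2 ^ (s / 2) * weight s y * weight s (x - y) := by
  have hbase : 1 + ‖x‖ ^ 2 ≤ 2 * (1 + ‖y‖ ^ 2) * (1 + ‖x - y‖ ^ 2) := by
    have htriangle : ‖x‖ ^ 2 ≤ (‖y‖ + ‖x - y‖) ^ 2 := by
      gcongr
      exact norm_le_norm_add_norm_sub' x y
    nlinarith [sq_nonneg (‖y‖ - ‖x - y‖), mul_nonneg (sq_nonneg ‖y‖) (sq_nonneg ‖x - y‖)]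
  rw [weight, weight, weight, ← Real.mul_rpow (by positivity) (by positivity),
    ← Real.mul_rpow (by positivity) (by positivity)]
  exact Real.rpow_le_rpow (by positivity) hbase (by positivity)

theorem weight_le_two_rpow_abs_mul (s : ℝ) (x y : Rn n) :
    weight s x ≤ 2 ^ (|s| / 2) * weight s y * weight |s| (x - y) := by
  rcases le_total 0 s with hs | hs
  · simpa only [abs_of_nonneg hs] using weight_le_two_rpow_mul hs x y
  · obtain ⟨t, rfl⟩ : ∃ t, s = -t := ⟨-s, (neg_neg s).symm⟩
    have h := weight_le_two_rpow_mul (neg_nonpos.mp hs) y x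
    rw [abs_neg, abs_of_nonneg (neg_nonpos.mp hs), weight_neg, weight_neg, ← neg_sub,
      weight_apply_neg, inv_le_iff_one_le_mul₀ (weight_pos t x), ← div_eq_mul_inv,
      div_mul_eq_mul_div, div_mul_eq_mul_div, one_le_div (weight_pos t y)]
    exact h.trans_eq (by ring)

theorem weight_le_one_add_norm_pow {s : ℝ} {N : ℕ} (hs : s ≤ N) (x : Rn n) :
    weight s x ≤ (1 + ‖x‖) ^ N := by
  calc weight s x ≤ weight N x :=
        Real.rpow_le_rpow_of_exponent_le (by simp) (by gcongr)
    _ ≤ ((1 + ‖x‖) ^ 2) ^ ((N : ℝ) / 2) :=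
        Real.rpow_le_rpow (by positivity) (by nlinarith [norm_nonneg x]) (by positivity)
    _ = (1 + ‖x‖) ^ N := by
        rw [← Real.rpow_natCast_mul (by positivity), Nat.cast_ofNat,
          mul_div_cancel₀ _ two_ne_zero, Real.rpow_natCast]

end Weight

section TrigonometricSeries

variable {n : ℕ} {d : (Fin n → ℤ) → ℂ} {V : Rn n → ℂ}

theorem summable_norm_of_hasSum_mul_planeWave
    (hV : ∀ x, HasSum (fun β => d β * planeWave (latticePoint β) x) (V x)) :
    Summable fun β => ‖d β‖ := by
  simpa only [norm_mul, norm_planeWave, mul_one] using (hV 0).summable.norm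

theorem eLpNorm_top_le_tsum_enorm
    (hV : ∀ x, HasSum (fun β => d β * planeWave (latticePoint β) x) (V x)) :
    eLpNorm V ∞ volume ≤ ∑' β, ‖d β‖ₑ := by
  rw [eLpNorm_exponent_top]
  refine essSup_le_of_ae_le _ (.of_forall fun x => ?_)
  have hnorm (β : Fin n → ℤ) : ‖d β‖ₑ = ‖d β * planeWave (latticePoint β) x‖ₑ := by
    rw [← ofReal_norm, ← ofReal_norm, norm_mul, norm_planeWave, mul_one]
  simp only [hnorm, ← (hV x).tsum_eq]
  exact enorm_tsum_le_tsum_enorm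

theorem IsPeriodicPartition.coefficient_eq_integral {φ : 𝓢(Rn n, ℂ)}
    (hφ : IsPeriodicPartition φ)
    (hV : ∀ x, HasSum (fun β => d β * planeWave (latticePoint β) x) (V x)) (α : Fin n → ℤ) :
    d α * (2 * π : ℂ) ^ n = ∫ x, φ x * (V x * planeWave (-latticePoint α) x) := by
  let term (β : Fin n → ℤ) (x : Rn n) : ℂ :=
    d β * (φ x * planeWave (latticePoint (β - α)) x)
  have hterm (x : Rn n) :
      HasSum (fun β => term β x) (φ x * (V x * planeWave (-latticePoint α) x)) := by
    convert! ((hV x).mul_right (planeWave (-latticePoint α) x)).mul_left (φ x) using 2 with β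
    rw [mul_assoc, ← planeWave_add, ← sub_eq_add_neg, ← latticePoint_sub, mul_left_comm]
  have hintegrable (β : Fin n → ℤ) : Integrable (term β) :=
    (φ.integrable.mul_bdd (c := 1) (continuous_planeWave _).aestronglyMeasurable
      (.of_forall fun x => (norm_planeWave _ x).le)).const_mul _
  have hsum := hasSum_integral_of_summable_integral_norm hintegrable (by
    simp only [term, norm_mul, norm_planeWave, mul_one, integral_const_mul]
    exact (summable_norm_of_hasSum_mul_planeWave hV).mul_right _)
  have hintegral (β : Fin n → ℤ) : ∫ x, term β x = d β * character (β - α) φ :=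
    integral_const_mul _ _
  simp only [(hterm _).tsum_eq, hintegral, hφ.character_eq, sub_eq_zero] at hsum
  have h := (hasSum_single α fun β hβ => by rw [if_neg hβ, mul_zero]).unique hsum
  rwa [if_pos rfl] at h

theorem IsPeriodicPartition.enorm_coefficient_mul_le {φ : 𝓢(Rn n, ℂ)}
    (hφ : IsPeriodicPartition φ)
    (hV : ∀ x, HasSum (fun β => d β * planeWave (latticePoint β) x) (V x)) (α : Fin n → ℤ) :
    ‖d α‖ₑ * ‖(2 * π : ℂ) ^ n‖ₑ ≤ (∫⁻ x, ‖φ x‖ₑ) * eLpNorm V ∞ volume := by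
  rw [← enorm_mul, hφ.coefficient_eq_integral hV, eLpNorm_exponent_top,
    ← lintegral_mul_const _ φ.continuous.measurable.enorm]
  refine (enorm_integral_le_lintegral_enorm _).trans (lintegral_mono_ae ?_)
  filter_upwards [ae_le_eLpNormEssSup (f := V)] with x hx
  have hnorm : ‖V x * planeWave (-latticePoint α) x‖ₑ = ‖V x‖ₑ := by
    rw [← ofReal_norm, ← ofReal_norm, norm_mul, norm_planeWave, mul_one]
  rw [enorm_mul, hnorm]
  gcongr

end TrigonometricSeries

section ShortTimeFourierTransform

variable {n : ℕ}

/-- The Fourier transform of the complex conjugate of the window `g`. -/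
noncomputable def windowTransform (g : 𝓢(Rn n, ℂ)) : 𝓢(Rn n, ℂ) :=
  angularFourier (SchwartzMap.postcompCLM (𝕜 := ℝ) (Complex.conjCLE : ℂ →L[ℝ] ℂ) g)

theorem windowTransform_ne_zero {g : 𝓢(Rn n, ℂ)} (hg : g ≠ 0) : windowTransform g ≠ 0 := by
  rw [windowTransform, ne_eq, map_eq_zero_iff _ angularFourier.injective]
  refine fun h => hg (SchwartzMap.ext fun x => ?_)
  simpa using DFunLike.congr_fun h x

theorem character_conjTimeFreqShift (g : 𝓢(Rn n, ℂ)) (x ξ : Rn n) (α : Fin n → ℤ) :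
    character α (conjTimeFreqShift g x ξ) =
      windowTransform g (ξ - latticePoint α) * planeWave (latticePoint α - ξ) x := by
  have hshift : conjTimeFreqShift g x ξ = demodulate ξ (SchwartzMap.compSubConstCLM ℂ x
      (SchwartzMap.postcompCLM (𝕜 := ℝ) (Complex.conjCLE : ℂ →L[ℝ] ℂ) g)) := rfl
  rw [character_eq_angularFourier, hshift, angularFourier_demodulate,
    SchwartzMap.compSubConstCLM_apply, sub_neg_eq_add, neg_add_eq_sub,
    angularFourier_compSubConstCLM, neg_sub, windowTransform]

/-- The coefficient of `e^{i x·α}` in the trigonometric series `x ↦ e^{i x·ξ} V_g f(x, ξ)`, for a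
periodic distribution `f` with Fourier coefficients `c`. -/
noncomputable def stftCoefficient (g : 𝓢(Rn n, ℂ)) (c : (Fin n → ℤ) → ℂ) (ξ : Rn n)
    (α : Fin n → ℤ) : ℂ :=
  (((2 * π) ^ (-(n : ℝ) / 2) : ℝ) : ℂ) * (c α * windowTransform g (ξ - latticePoint α))

theorem IsPeriodic.hasSum_stft_mul_planeWave {f : 𝓢'(Rn n, ℂ)} (hf : IsPeriodic f)
    {φ : 𝓢(Rn n, ℂ)} (hφ : IsPeriodicPartition φ) (g : 𝓢(Rn n, ℂ)) (ξ x : Rn n) :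
    HasSum (fun α => stftCoefficient g (fourierCoefficient φ f) ξ α *
      planeWave (latticePoint α) x) (stft g f x ξ * planeWave ξ x) := by
  have h := ((hf.hasSum_fourierCoefficient_apply hφ (conjTimeFreqShift g x ξ)).mul_left
    (((2 * π) ^ (-(n : ℝ) / 2) : ℝ) : ℂ)).mul_right (planeWave ξ x)
  convert! h using 2 with α
  have hwave : planeWave (latticePoint α) x =
      planeWave (latticePoint α - ξ) x * planeWave ξ x := by
    rw [← planeWave_add, sub_add_cancel]
  rw [character_conjTimeFreqShift, stftCoefficient, hwave]
  ring

/-- The inner norm `ess sup_x |V_g f(x, ξ)| ⟨ξ⟩^s` in the definition of `modulationNorm` with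
`p = ∞` and `σ = 0`. -/
noncomputable def frequencySup (g : 𝓢(Rn n, ℂ)) (s : ℝ) (f : 𝓢'(Rn n, ℂ)) (ξ : Rn n) : ℝ≥0∞ :=
  eLpNorm (fun x : Rn n => stft g f x ξ * ((weight 0 x * weight s ξ : ℝ) : ℂ)) ∞ volume

theorem frequencySup_eq (g : 𝓢(Rn n, ℂ)) (s : ℝ) (f : 𝓢'(Rn n, ℂ)) (ξ : Rn n) :
    frequencySup g s f ξ = ‖(weight s ξ : ℂ)‖ₑ *
      eLpNorm (fun x => stft g f x ξ * planeWave ξ x) ∞ volume := by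
  rw [← eLpNorm_const_smul]
  refine eLpNorm_congr_norm_ae (.of_forall fun x => ?_)
  simp [weight, norm_planeWave, mul_comm]

theorem IsPeriodic.frequencySup_le_tsum {f : 𝓢'(Rn n, ℂ)} (hf : IsPeriodic f)
    {φ : 𝓢(Rn n, ℂ)} (hφ : IsPeriodicPartition φ) (g : 𝓢(Rn n, ℂ)) (s : ℝ) (ξ : Rn n) :
    frequencySup g s f ξ ≤
      ∑' α, ‖(weight s ξ : ℂ) * stftCoefficient g (fourierCoefficient φ f) ξ α‖ₑ := by
  simp only [enorm_mul, ENNReal.tsum_mul_left, frequencySup_eq]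
  gcongr
  exact eLpNorm_top_le_tsum_enorm (hf.hasSum_stft_mul_planeWave hφ g ξ)

theorem IsPeriodic.exists_enorm_stftCoefficient_le {f : 𝓢'(Rn n, ℂ)} (hf : IsPeriodic f)
    {φ : 𝓢(Rn n, ℂ)} (hφ : IsPeriodicPartition φ) (g : 𝓢(Rn n, ℂ)) (s : ℝ) :
    ∃ C : ℝ≥0∞, C ≠ ∞ ∧ ∀ ξ α,
      ‖(weight s ξ : ℂ) * stftCoefficient g (fourierCoefficient φ f) ξ α‖ₑ ≤
        C * frequencySup g s f ξ := by
  have hpi : ‖(2 * π : ℂ) ^ n‖ₑ ≠ 0 := by simp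
  refine ⟨(∫⁻ x, ‖φ x‖ₑ) / ‖(2 * π : ℂ) ^ n‖ₑ,
    ENNReal.div_ne_top φ.integrable.hasFiniteIntegral.ne hpi, fun ξ α => ?_⟩
  have h := hφ.enorm_coefficient_mul_le (hf.hasSum_stft_mul_planeWave hφ g ξ) α
  rw [← ENNReal.le_div_iff_mul_le (.inl hpi) (.inl enorm_ne_top), ENNReal.mul_div_right_comm] at h
  rw [enorm_mul, frequencySup_eq, mul_left_comm]
  gcongr

theorem exists_norm_weight_mul_stftCoefficient_le (g : 𝓢(Rn n, ℂ)) (s : ℝ) (N : ℕ) :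
    ∃ C : ℝ, 0 ≤ C ∧ ∀ (c : (Fin n → ℤ) → ℂ) (ξ : Rn n) (α : Fin n → ℤ),
      ‖(weight s ξ : ℂ) * stftCoefficient g c ξ α‖ ≤
        C * ((1 + ‖ξ - latticePoint α‖) ^ N)⁻¹ * ‖(weight s (latticePoint α) : ℂ) * c α‖ := by
  obtain ⟨M, hM⟩ := exists_nat_ge |s|
  obtain ⟨C, hC, hdecay⟩ := exists_norm_le_mul_one_add_norm_pow_inv (windowTransform g) (M + N)
  refine ⟨(2 * π) ^ (-(n : ℝ) / 2) * 2 ^ (|s| / 2) * C, by positivity, fun c ξ α => ?_⟩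
  have hwindow : weight |s| (ξ - latticePoint α) * ‖windowTransform g (ξ - latticePoint α)‖ ≤
      C * ((1 + ‖ξ - latticePoint α‖) ^ N)⁻¹ := by
    calc _ ≤ (1 + ‖ξ - latticePoint α‖) ^ M *
          (C * ((1 + ‖ξ - latticePoint α‖) ^ (M + N))⁻¹) := by
          gcongr
          exacts [weight_le_one_add_norm_pow hM _, hdecay _]
      _ = C * ((1 + ‖ξ - latticePoint α‖) ^ N)⁻¹ := by
          rw [pow_add]
          field_simp
  calc ‖(weight s ξ : ℂ) * stftCoefficient g c ξ α‖
      = (2 * π) ^ (-(n : ℝ) / 2) * weight s ξ *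
          (‖c α‖ * ‖windowTransform g (ξ - latticePoint α)‖) := by
        rw [stftCoefficient, norm_mul, norm_mul, norm_mul, norm_weight, norm_real,
          Real.norm_of_nonneg (by positivity)]
        ring
    _ ≤ (2 * π) ^ (-(n : ℝ) / 2) * (2 ^ (|s| / 2) * weight s (latticePoint α) *
          weight |s| (ξ - latticePoint α)) *
            (‖c α‖ * ‖windowTransform g (ξ - latticePoint α)‖) := by
        gcongr
        exact weight_le_two_rpow_abs_mul s ξ (latticePoint α)
    _ = (2 * π) ^ (-(n : ℝ) / 2) * 2 ^ (|s| / 2) * (weight |s| (ξ - latticePoint α) *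
          ‖windowTransform g (ξ - latticePoint α)‖) * (weight s (latticePoint α) * ‖c α‖) := by
        ring
    _ ≤ _ := by
        rw [norm_mul, norm_weight, mul_assoc _ C]
        have := weight_pos s (latticePoint α)
        gcongr

theorem exists_weight_lower_bound_windowTransform {g : 𝓢(Rn n, ℂ)} (hg : g ≠ 0) (s : ℝ) :
    ∃ (η : Rn n) (r δ : ℝ), 0 < r ∧ r ≤ 1 / 2 ∧ 0 < δ ∧
      ∀ ζ ∈ Metric.ball η r, weight s ζ ≤ δ⁻¹ * ‖windowTransform g ζ‖ := by
  obtain ⟨η, hη⟩ := DFunLike.ne_iff.mp (windowTransform_ne_zero hg)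
  have hcont : Continuous fun ζ => ‖windowTransform g ζ‖ / weight s ζ :=
    (windowTransform g).continuous.norm.div₀ (continuous_weight s) fun ζ => (weight_pos s ζ).ne'
  have hpos : 0 < ‖windowTransform g η‖ / weight s η :=
    div_pos (norm_pos_iff.mpr hη) (weight_pos s η)
  obtain ⟨r, hr, hball⟩ := Metric.eventually_nhds_iff_ball.mp
    (hcont.continuousAt.eventually_const_lt (half_lt_self hpos))
  refine ⟨η, min r (1 / 2), _, lt_min hr (by norm_num), min_le_right _ _, half_pos hpos,
    fun ζ hζ => ?_⟩
  rw [le_inv_mul_iff₀ (half_pos hpos), ← le_div_iff₀ (weight_pos s ζ)]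
  exact (hball ζ (Metric.ball_subset_ball (min_le_left _ _) hζ)).le

theorem exists_norm_weight_mul_le_on_ball {g : 𝓢(Rn n, ℂ)} (hg : g ≠ 0) (s : ℝ) :
    ∃ (η : Rn n) (r C : ℝ), 0 < r ∧ r ≤ 1 / 2 ∧ 0 ≤ C ∧
      ∀ (c : (Fin n → ℤ) → ℂ) (α : Fin n → ℤ), ∀ ξ ∈ Metric.ball (latticePoint α + η) r,
        ‖(weight s (latticePoint α) : ℂ) * c α‖ ≤
          C * ‖(weight s ξ : ℂ) * stftCoefficient g c ξ α‖ := by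
  obtain ⟨η, r, δ, hr, hr', hδ, hball⟩ := exists_weight_lower_bound_windowTransform hg |s|
  refine ⟨η, r, 2 ^ (|s| / 2) * δ⁻¹ * ((2 * π) ^ (-(n : ℝ) / 2))⁻¹, hr, hr', by positivity,
    fun c α ξ hξ => ?_⟩
  have hζ : ξ - latticePoint α ∈ Metric.ball η r := by
    rwa [mem_ball_iff_norm, sub_sub, ← mem_ball_iff_norm]
  have hwξ := weight_pos s ξ
  calc ‖(weight s (latticePoint α) : ℂ) * c α‖
      = weight s (latticePoint α) * ‖c α‖ := by rw [norm_mul, norm_weight]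
    _ ≤ 2 ^ (|s| / 2) * weight s ξ * weight |s| (ξ - latticePoint α) * ‖c α‖ := by
        gcongr
        rw [← weight_apply_neg |s|, neg_sub]
        exact weight_le_two_rpow_abs_mul s _ _
    _ ≤ 2 ^ (|s| / 2) * weight s ξ * (δ⁻¹ * ‖windowTransform g (ξ - latticePoint α)‖) *
          ‖c α‖ := by
        gcongr
        exact hball _ hζ
    _ = _ := by
        rw [stftCoefficient, norm_mul, norm_mul, norm_mul, norm_weight, norm_real,
          Real.norm_of_nonneg (by positivity : (0 : ℝ) ≤ (2 * π) ^ (-(n : ℝ) / 2))]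
        field_simp

end ShortTimeFourierTransform

section SequenceNorm

theorem memℓp_iff_eLpNorm_count_lt_top {ι E : Type*} [MeasurableSpace ι]
    [MeasurableSingletonClass ι] [NormedAddCommGroup E] {q : ℝ≥0∞} (hq : q ≠ 0) (c : ι → E) :
    Memℓp c q ↔ eLpNorm c q Measure.count < ∞ := by
  rcases eq_or_ne q ∞ with rfl | hq'
  · rw [memℓp_infty_iff, eLpNorm_exponent_top, eLpNormEssSup_count]
    simp only [← ofReal_norm, iSup_lt_iff, Set.forall_mem_range, bddAbove_def]
    refine ⟨fun ⟨C, hC⟩ => ⟨ENNReal.ofReal C, ENNReal.ofReal_lt_top,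
      fun i => ENNReal.ofReal_le_ofReal (hC i)⟩, fun ⟨C, hC, h⟩ => ⟨C.toReal, fun i => ?_⟩⟩
    exact (ENNReal.ofReal_le_iff_le_toReal hC.ne).mp (h i)
  · have hnorm (i : ι) : ‖c i‖ₑ ^ q.toReal = ENNReal.ofReal (‖c i‖ ^ q.toReal) := by
      rw [← ofReal_norm, ENNReal.ofReal_rpow_of_nonneg (norm_nonneg _) ENNReal.toReal_nonneg]
    rw [memℓp_gen_iff (ENNReal.toReal_pos hq hq'),
      eLpNorm_lt_top_iff_lintegral_rpow_enorm_lt_top hq hq', lintegral_count]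
    simp only [hnorm]
    refine ⟨fun h => h.tsum_ofReal_lt_top,
      fun h => (ENNReal.summable_toReal h.ne).congr fun i => ?_⟩
    exact ENNReal.toReal_ofReal (by positivity)

variable {ι X ε ε' : Type*} [MeasurableSpace ι] [MeasurableSingletonClass ι] [MeasurableSpace X]
  [ENorm ε] [ENorm ε']
  {μ : Measure X} {S : ι → Set X} {b : ι → ε} {F : X → ε'} {D m : ℝ≥0∞}

theorem eLpNorm_top_count_lt_top_of_enorm_le_on (hμ : ∀ i, μ (S i) ≠ 0) (hD : D ≠ ∞)
    (hle : ∀ i, ∀ x ∈ S i, ‖b i‖ₑ ≤ D * ‖F x‖ₑ) (hF : eLpNorm F ∞ μ < ∞) :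
    eLpNorm b ∞ Measure.count < ∞ := by
  rw [eLpNorm_exponent_top] at hF ⊢
  rw [eLpNormEssSup_count]
  refine (iSup_le fun i => ?_).trans_lt (ENNReal.mul_lt_top hD.lt_top hF)
  obtain ⟨x, hx, hFx⟩ := ((frequently_ae_mem_iff.mpr (hμ i)).and_eventually
    (ae_le_eLpNormEssSup (f := F))).exists
  exact (hle i x hx).trans (by gcongr)

theorem eLpNorm_count_lt_top_of_enorm_le_on_disjoint [Countable ι]
    (hS : ∀ i, MeasurableSet (S i)) (hdisj : Pairwise (Function.onFun Disjoint S))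
    (hm : m ≠ 0) (hμ : ∀ i, m ≤ μ (S i)) (hD : D ≠ ∞)
    (hle : ∀ i, ∀ x ∈ S i, ‖b i‖ₑ ≤ D * ‖F x‖ₑ) {q : ℝ≥0∞} (hF : eLpNorm F q μ < ∞) :
    eLpNorm b q Measure.count < ∞ := by
  rcases eq_or_ne q 0 with rfl | hq
  · simp
  rcases eq_or_ne q ∞ with rfl | hq'
  · exact eLpNorm_top_count_lt_top_of_enorm_le_on
      (fun i => (hm.bot_lt.trans_le (hμ i)).ne') hD hle hF
  rw [eLpNorm_lt_top_iff_lintegral_rpow_enorm_lt_top hq hq'] at hF ⊢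
  rw [lintegral_count]
  set p := q.toReal
  have hp : 0 ≤ p := ENNReal.toReal_nonneg
  have hDp : D ^ p ≠ ∞ := ENNReal.rpow_ne_top_of_nonneg hp hD
  have hterm (i : ι) : ‖b i‖ₑ ^ p * m ≤ ∫⁻ x in S i, D ^ p * ‖F x‖ₑ ^ p ∂μ := by
    calc ‖b i‖ₑ ^ p * m ≤ ‖b i‖ₑ ^ p * μ (S i) := by gcongr; exact hμ i
      _ = ∫⁻ _ in S i, ‖b i‖ₑ ^ p ∂μ := (setLIntegral_const _ _).symm
      _ ≤ _ := setLIntegral_mono' (hS i) fun x hx => by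
        rw [← ENNReal.mul_rpow_of_nonneg _ _ hp]
        exact ENNReal.rpow_le_rpow (hle i x hx) hp
  have hsum : (∑' i, ‖b i‖ₑ ^ p) * m ≤ D ^ p * ∫⁻ x, ‖F x‖ₑ ^ p ∂μ := by
    calc (∑' i, ‖b i‖ₑ ^ p) * m = ∑' i, ‖b i‖ₑ ^ p * m := ENNReal.tsum_mul_right.symm
      _ ≤ ∑' i, ∫⁻ x in S i, D ^ p * ‖F x‖ₑ ^ p ∂μ := ENNReal.tsum_le_tsum hterm
      _ = ∫⁻ x in ⋃ i, S i, D ^ p * ‖F x‖ₑ ^ p ∂μ := (lintegral_iUnion hS hdisj _).symm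
      _ ≤ ∫⁻ x, D ^ p * ‖F x‖ₑ ^ p ∂μ := setLIntegral_le_lintegral _ _
      _ = _ := lintegral_const_mul' _ _ hDp
  exact ENNReal.lt_top_of_mul_ne_top_left
    (hsum.trans_lt (ENNReal.mul_lt_top hDp.lt_top hF)).ne hm

end SequenceNorm

section DiscreteConvolution

variable {ι : Type*} {p : ℝ}

theorem tsum_rpow_le_of_forall_sum_rpow_le (hp : 0 < p) {a : ι → ℝ≥0∞} {B : ℝ≥0∞}
    (h : ∀ t : Finset ι, (∑ i ∈ t, a i) ^ p ≤ B) : (∑' i, a i) ^ p ≤ B := by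
  rw [← ENNReal.le_rpow_inv_iff hp, ENNReal.tsum_eq_iSup_sum]
  exact iSup_le fun t => (ENNReal.le_rpow_inv_iff hp).mpr (h t)

theorem tsum_rpow_le_tsum_rpow (hp : 0 < p) (hp' : p ≤ 1) (a : ι → ℝ≥0∞) :
    (∑' i, a i) ^ p ≤ ∑' i, a i ^ p :=
  tsum_rpow_le_of_forall_sum_rpow_le hp fun t =>
    (Finset.le_sum_of_subadditive (· ^ p) (ENNReal.zero_rpow_of_pos hp).le
      (fun x y => ENNReal.rpow_add_le_add_rpow x y hp.le hp') t a).trans (ENNReal.sum_le_tsum t)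

theorem tsum_mul_rpow_le (hp : 1 ≤ p) (w b : ι → ℝ≥0∞) :
    (∑' i, w i * b i) ^ p ≤ (∑' i, w i) ^ (p - 1) * ∑' i, w i * b i ^ p := by
  have hp0 : 0 < p := zero_lt_one.trans_le hp
  refine tsum_rpow_le_of_forall_sum_rpow_le hp0 fun t => ?_
  calc (∑ i ∈ t, w i * b i) ^ p
      ≤ ((∑ i ∈ t, w i) ^ (1 - p⁻¹) * (∑ i ∈ t, w i * b i ^ p) ^ p⁻¹) ^ p := by
        gcongr
        exact ENNReal.inner_le_weight_mul_Lp_of_nonneg t hp w b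
    _ = (∑ i ∈ t, w i) ^ (p - 1) * ∑ i ∈ t, w i * b i ^ p := by
        rw [ENNReal.mul_rpow_of_nonneg _ _ hp0.le, ENNReal.rpow_inv_rpow hp0.ne',
          ← ENNReal.rpow_mul, sub_mul, one_mul, inv_mul_cancel₀ hp0.ne']
    _ ≤ _ := by
        gcongr
        exacts [ENNReal.sum_le_tsum t, ENNReal.sum_le_tsum t]

variable {n : ℕ}

/-- The function `(1 + |η|)^{-N}` with values in `[0, ∞]`, which dominates the Fourier transform of
a Schwartz window. -/
noncomputable def decayKernel (N : ℕ) (η : Rn n) : ℝ≥0∞ := ENNReal.ofReal ((1 + ‖η‖) ^ N)⁻¹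

theorem measurable_decayKernel (N : ℕ) : Measurable (decayKernel N : Rn n → ℝ≥0∞) := by
  unfold decayKernel
  fun_prop

theorem decayKernel_rpow_le {N M : ℕ} (hM : M ≤ N * p) (hp : 0 ≤ p) (η : Rn n) :
    decayKernel N η ^ p ≤ decayKernel M η := by
  rw [decayKernel, ENNReal.ofReal_rpow_of_nonneg (by positivity) hp, decayKernel,
    Real.inv_rpow (by positivity), ← Real.rpow_natCast_mul (by positivity), ← Real.rpow_natCast]
  refine ENNReal.ofReal_le_ofReal (inv_anti₀ (by positivity) ?_)
  exact Real.rpow_le_rpow_of_exponent_le (by simp) hM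

theorem lintegral_decayKernel_lt_top : ∫⁻ η : Rn n, decayKernel (n + 1) η < ∞ := by
  have hintegrable : Integrable fun η : Rn n => (1 + ‖η‖) ^ (-((n + 1 : ℕ) : ℝ)) :=
    integrable_one_add_norm (by simp)
  refine lt_of_eq_of_lt (lintegral_congr fun η => ?_) hintegrable.lintegral_lt_top
  rw [decayKernel, Real.rpow_neg (by positivity), Real.rpow_natCast]

theorem exists_tsum_decayKernel_le (n : ℕ) :
    ∃ M : ℝ≥0∞, M ≠ ∞ ∧ ∀ ξ : Rn n, ∑' α, decayKernel (n + 1) (ξ - latticePoint α) ≤ M := by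
  refine ⟨ENNReal.ofReal ((1 + √n) ^ (n + 1)) *
    ∑' α : Fin n → ℤ, decayKernel (n + 1) (latticePoint α), ENNReal.mul_ne_top
    ENNReal.ofReal_ne_top summable_one_add_norm_latticePoint_pow_inv.tsum_ofReal_ne_top,
    fun ξ => ?_⟩
  obtain ⟨β, hβ⟩ := exists_norm_sub_latticePoint_le ξ
  rw [← (Equiv.addLeft β).tsum_eq, ← ENNReal.tsum_mul_left]
  refine ENNReal.tsum_le_tsum fun α => ?_
  have hbase : 1 + ‖latticePoint α‖ ≤ (1 + √n) * (1 + ‖ξ - latticePoint (β + α)‖) := by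
    refine (one_add_norm_le_mul_one_add_norm_sub _ (ξ - latticePoint β)).trans ?_
    rw [latticePoint_add, sub_sub]
    gcongr
  rw [decayKernel, decayKernel, ← ENNReal.ofReal_mul (by positivity), Equiv.coe_addLeft,
    ← div_eq_mul_inv, inv_eq_one_div]
  refine ENNReal.ofReal_le_ofReal ((div_le_div_iff₀ (by positivity) (by positivity)).mpr ?_)
  rw [one_mul, ← mul_pow]
  gcongr

theorem exists_tsum_decayKernel_mul_rpow_le (n : ℕ) (hp : 0 < p) :
    ∃ (N : ℕ) (A : ℝ≥0∞), A ≠ ∞ ∧ ∀ (b : (Fin n → ℤ) → ℝ≥0∞) (ξ : Rn n),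
      (∑' α, decayKernel N (ξ - latticePoint α) * b α) ^ p ≤
        A * ∑' α, decayKernel (n + 1) (ξ - latticePoint α) * b α ^ p := by
  rcases le_total 1 p with hp' | hp'
  · obtain ⟨M, hM, hle⟩ := exists_tsum_decayKernel_le n
    refine ⟨n + 1, M ^ (p - 1), ENNReal.rpow_ne_top_of_nonneg (by linarith) hM, fun b ξ => ?_⟩
    refine (tsum_mul_rpow_le hp' _ _).trans ?_
    gcongr
    exact hle ξ
  · obtain ⟨N, hN⟩ := exists_nat_ge (((n + 1 : ℕ) : ℝ) / p)
    refine ⟨N, 1, ENNReal.one_ne_top, fun b ξ => ?_⟩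
    rw [one_mul]
    refine (tsum_rpow_le_tsum_rpow hp hp' _).trans (ENNReal.tsum_le_tsum fun α => ?_)
    rw [ENNReal.mul_rpow_of_nonneg _ _ hp.le]
    gcongr
    exact decayKernel_rpow_le ((div_le_iff₀ hp).mp hN) hp.le _

theorem lintegral_tsum_decayKernel_mul_lt_top {b : (Fin n → ℤ) → ℝ≥0∞} (hb : ∑' α, b α < ∞) :
    ∫⁻ ξ : Rn n, ∑' α, decayKernel (n + 1) (ξ - latticePoint α) * b α < ∞ := by
  have hmeas (α : Fin n → ℤ) :
      Measurable fun ξ : Rn n => decayKernel (n + 1) (ξ - latticePoint α) :=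
    (measurable_decayKernel _).comp (measurable_id.sub_const _)
  rw [lintegral_tsum fun α => ((hmeas α).mul_const _).aemeasurable]
  simp only [lintegral_mul_const _ (hmeas _), lintegral_sub_right_eq_self (μ := volume)
    (decayKernel (n + 1) : Rn n → ℝ≥0∞), ENNReal.tsum_mul_left]
  exact ENNReal.mul_lt_top lintegral_decayKernel_lt_top hb

theorem exists_eLpNorm_tsum_decayKernel_lt_top (n : ℕ) (q : ℝ≥0∞) :
    ∃ N : ℕ, ∀ b : (Fin n → ℤ) → ℝ≥0∞, eLpNorm b q Measure.count < ∞ →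
      eLpNorm (fun ξ : Rn n => ∑' α, decayKernel N (ξ - latticePoint α) * b α) q volume < ∞ := by
  rcases eq_or_ne q 0 with rfl | hq
  · exact ⟨0, fun b _ => by simp⟩
  rcases eq_or_ne q ∞ with rfl | hq'
  · obtain ⟨M, hM, hle⟩ := exists_tsum_decayKernel_le n
    refine ⟨n + 1, fun b hb => ?_⟩
    rw [eLpNorm_exponent_top, eLpNormEssSup_count] at hb
    refine (eLpNormEssSup_le_of_ae_enorm_bound (C := M * ⨆ α, b α)
      (.of_forall fun ξ => ?_)).trans_lt (ENNReal.mul_lt_top hM.lt_top hb)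
    calc ‖∑' α, decayKernel (n + 1) (ξ - latticePoint α) * b α‖ₑ
        ≤ ∑' α, decayKernel (n + 1) (ξ - latticePoint α) * ⨆ α, b α :=
          ENNReal.tsum_le_tsum fun α => by gcongr; exact le_iSup b α
      _ ≤ M * ⨆ α, b α := by
          rw [ENNReal.tsum_mul_right]
          gcongr
          exact hle ξ
  · obtain ⟨N, A, hA, hle⟩ :=
      exists_tsum_decayKernel_mul_rpow_le n (ENNReal.toReal_pos hq hq')
    refine ⟨N, fun b hb => ?_⟩
    rw [eLpNorm_lt_top_iff_lintegral_rpow_enorm_lt_top hq hq'] at hb ⊢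
    rw [lintegral_count] at hb
    refine (lintegral_mono (hle b)).trans_lt ?_
    rw [lintegral_const_mul' _ _ hA]
    exact ENNReal.mul_lt_top hA.lt_top (lintegral_tsum_decayKernel_mul_lt_top hb)

end DiscreteConvolution

section Characterization

variable {n : ℕ} {φ : 𝓢(Rn n, ℂ)} {f : 𝓢'(Rn n, ℂ)} {q : ℝ≥0∞}

theorem IsPeriodic.mem_weightedSequenceSpace (hf : IsPeriodic f) (hφ : IsPeriodicPartition φ)
    {g : 𝓢(Rn n, ℂ)} (hg : g ≠ 0) (s : ℝ) (hq : q ≠ 0) (h : f ∈ modulationSpace g ∞ q s 0) :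
    fourierCoefficient φ f ∈ weightedSequenceSpace n q s := by
  obtain ⟨η, r, C, hr, hr', hC, hball⟩ := exists_norm_weight_mul_le_on_ball hg s
  obtain ⟨D, hD, hsup⟩ := hf.exists_enorm_stftCoefficient_le hφ g s
  refine (memℓp_iff_eLpNorm_count_lt_top hq _).mpr <|
    eLpNorm_count_lt_top_of_enorm_le_on_disjoint (F := frequencySup g s f)
      (D := ENNReal.ofReal C * D) (fun _ => measurableSet_ball)
      (pairwise_disjoint_ball_latticePoint_add η hr') (Metric.measure_ball_pos volume 0 hr).ne'
      (fun α => (Measure.addHaar_ball_center volume _ r).ge)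
      (ENNReal.mul_ne_top ENNReal.ofReal_ne_top hD) (fun α ξ hξ => ?_) h
  calc ‖(weight s (latticePoint α) : ℂ) * fourierCoefficient φ f α‖ₑ
      ≤ ENNReal.ofReal C *
          ‖(weight s ξ : ℂ) * stftCoefficient g (fourierCoefficient φ f) ξ α‖ₑ := by
        rw [← ofReal_norm, ← ofReal_norm, ← ENNReal.ofReal_mul hC]
        exact ENNReal.ofReal_le_ofReal (hball _ α ξ hξ)
    _ ≤ ENNReal.ofReal C * D * frequencySup g s f ξ := by
        rw [mul_assoc]
        gcongr
        exact hsup ξ α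

theorem IsPeriodic.mem_modulationSpace (hf : IsPeriodic f) (hφ : IsPeriodicPartition φ)
    (g : 𝓢(Rn n, ℂ)) {s : ℝ} (hq : q ≠ 0)
    (h : fourierCoefficient φ f ∈ weightedSequenceSpace n q s) :
    f ∈ modulationSpace g ∞ q s 0 := by
  set b : (Fin n → ℤ) → ℂ := fun α => weight s (latticePoint α) * fourierCoefficient φ f α
  have hb : eLpNorm (fun α => ‖b α‖ₑ) q Measure.count < ∞ := by
    rw [eLpNorm_enorm]
    exact (memℓp_iff_eLpNorm_count_lt_top hq b).mp h
  obtain ⟨N, hN⟩ := exists_eLpNorm_tsum_decayKernel_lt_top n q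
  obtain ⟨C, hC, hdecay⟩ := exists_norm_weight_mul_stftCoefficient_le g s N
  have hsup (ξ : Rn n) : ‖frequencySup g s f ξ‖ₑ ≤ C.toNNReal *
      ‖∑' α, decayKernel N (ξ - latticePoint α) * ‖b α‖ₑ‖ₑ := by
    rw [enorm_eq_self, enorm_eq_self, ← ENNReal.tsum_mul_left]
    refine (hf.frequencySup_le_tsum hφ g s ξ).trans (ENNReal.tsum_le_tsum fun α => ?_)
    rw [← ofReal_norm, ← ofReal_norm, decayKernel, ← ENNReal.ofReal, ← mul_assoc,
      ← ENNReal.ofReal_mul hC, ← ENNReal.ofReal_mul (by positivity)]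
    exact ENNReal.ofReal_le_ofReal (hdecay _ ξ α)
  exact (eLpNorm_le_nnreal_smul_eLpNorm_of_ae_le_mul' (.of_forall hsup) q).trans_lt
    (ENNReal.mul_lt_top ENNReal.coe_lt_top (hN _ hb))

end Characterization

end PeriodicModulation

theorem mainTheorem7_general (n : ℕ) (q : ℝ≥0∞) (hq : q ≠ 0) (s : ℝ)
    (φ : 𝓢(PeriodicModulation.Rn n, ℂ)) (hφ : PeriodicModulation.IsPeriodicPartition φ)
    (g : 𝓢(PeriodicModulation.Rn n, ℂ)) (hg : g ≠ 0)
    (f : 𝓢'(PeriodicModulation.Rn n, ℂ)) (hf : PeriodicModulation.IsPeriodic f) :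
    HasSum (fun α : Fin n → ℤ =>
        PeriodicModulation.fourierCoefficient φ f α • PeriodicModulation.character α) f ∧
      (f ∈ PeriodicModulation.modulationSpace g ∞ q s 0 ↔
        PeriodicModulation.fourierCoefficient φ f ∈
          PeriodicModulation.weightedSequenceSpace n q s) :=
  ⟨hf.hasSum_fourierCoefficient_smul_character hφ,
    hf.mem_weightedSequenceSpace hφ hg s hq, hf.mem_modulationSpace hφ g hq⟩

theorem mainTheorem7 (n : ℕ) (q : ℝ≥0∞) (hq : 1 ≤ q) (hq' : q ≠ ∞) (s : ℝ) (hs : 1 < s)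
    (φ : 𝓢(PeriodicModulation.Rn n, ℂ)) (hφ : PeriodicModulation.IsPeriodicPartition φ)
    (g : 𝓢(PeriodicModulation.Rn n, ℂ)) (hg : g ≠ 0)
    (f : 𝓢'(PeriodicModulation.Rn n, ℂ)) (hf : PeriodicModulation.IsPeriodic f) :
    HasSum (fun α : Fin n → ℤ =>
        PeriodicModulation.fourierCoefficient φ f α • PeriodicModulation.character α) f ∧
      (f ∈ PeriodicModulation.modulationSpace g ∞ q s 0 ↔
        PeriodicModulation.fourierCoefficient φ f ∈
          PeriodicModulation.weightedSequenceSpace n q s) :=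
  mainTheorem7_general n q (zero_lt_one.trans_le hq).ne' s φ hφ g hg f hf
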